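/- **Setting.** Let $I$ be a finite set of players and $S$ a finite set of parameters, with true parameter $s^*\in S$. Player $i$ has a convex strategy set $Q_i\subseteq\mathbb R^{d_i}$, and $Q=\prod_{i\in I} Q_i$. For $s\in S$ and $q\in Q$ the payoff vector $c\in\mathbb R^I$ has a probability density $\phi^s(\cdot\,|\,q)$ with finite means $u_i^s(q)=\int c_i\,\phi^s(c|q)\,dc$, and $q\mapsto\phi^s(c|q)$ is continuous on $Q$ for all $s$ and $c$. For a belief $\theta\in\Delta(S)$ let $\mathrm{EQ}(\theta)\subseteq Q$ be the set of Nash equilibria of the game with payoff functions $\sum_{s}\theta(s)u_i^s(q)$. Put $D_s(q)=D_{KL}\big(\phi^{s^*}(\cdot|q)\,\|\,\phi^{s}(\cdot|q)\big)\in[0,\infty]$ (equal to $\infty$ if $\phi^{s^*}(\cdot|q)\not\ll\phi^s(\cdot|q)$) and $S^*(q)=\{s\in S: D_s(q)=0\}$, the parameters payoff-equivalent to $s^*$ at $q$. Let the initial state be $\theta^1\in\Delta(S)$ with $\theta^1(s)>0$ for all $s$, and $q^1\in Q$. Let $g(\theta)\in \mathrm{EQ}(\theta)$ be an equilibrium selection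 and $a_i^k\in[0,1]$ stepsizes. Learning with equilibrium strategies is the random dynamics in which, for $k=1,2,\dots$, the payoff vector $c^k$, conditionally on $c^1,\dots,c^{k-1}$, has density $\phi^{s^*}(\cdot\,|\,q^k)$, and $$\theta^{k+1}(s)=\frac{\theta^k(s)\,\phi^s(c^k|q^k)}{\sum_{s'\in S}\theta^k(s')\,\phi^{s'}(c^k|q^k)},\qquad q_i^{k+1}=(1-a_i^k)\,q_i^k+a_i^k\,g_i(\theta^{k+1}).$$ **Theorem.** Assume (A1) $g$ is continuous on $\Delta(S)$, and (A2) $\prod_{k=m}^\infty(1-a_i^k)=0$ for all $i\in I$ and $m\ge 1$. Then with probability $1$ the sequence $(\theta^k,q^k)$ converges to a (random) limit $(\bar\theta,\bar q)\in\Delta(S)\times Q$ such that $$\{s:\bar\theta(s)>0\}\subseteq S^*(\bar q),\qquad \bar q=g(\bar\theta)\in \mathrm{EQ}(\bar\theta),$$ and the following holds for every $s\in S\setminus S^*(\bar q)$: 1. $\theta^k(s)$ decays exponentially, at rate at least $D_s(\bar q)$: for every real $r<D_s(\bar q)$, $\theta^k(s)\le e^{-rk}$ for all large $k$. 2. If there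 are $p>1$, $C<\infty$ and a neighbourhood $N$ of $\bar q$ in $Q$ such that for all $q\in N$ one has $\phi^{s^*}(\cdot|q)\ll\phi^s(\cdot|q)$ and $\int\phi^{s^*}(c|q)\,\big|\log\frac{\phi^{s^*}(c|q)}{\phi^s(c|q)}\big|^p\,dc\le C$, and if $\theta^k(s)>0$ for all $k$, then the rate is exactly the divergence: $\lim_{k\to\infty}\frac1k\log\theta^k(s)=-D_s(\bar q)$. 3. If $\phi^{s^*}(\cdot|\bar q)\not\ll\phi^{s}(\cdot|\bar q)$ and the probability under $\phi^{s^*}(\cdot|q)$ of $\{c:\phi^s(c|q)=0\}$ is continuous in $q\in Q$ at $\bar q$, then $\theta^k(s)=0$ for all large $k$. -/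

import Mathlib

open MeasureTheory ProbabilityTheory InformationTheory Filter Topology
open scoped NNReal ENNReal

/-- A strategy profile: player `i` chooses a vector in Euclidean space of dimension `d i`. -/
abbrev Profile {I : Type*} (d : I → ℕ) : Type _ := ∀ i, EuclideanSpace ℝ (Fin (d i))

/-- The game `G` with an unknown parameter: finitely many players `I`, parameters `S`,
convex strategy sets `Q i`, and, for every parameter `s` and every feasible profile `q`, a
probability density `φ s q` of the payoff vector `c : I → ℝ`, with finite means and continuous
in `q`. -/
structure ParametricGame (I S : Type*) [Fintype I] (d : I → ℕ) where
  /-- The strategy set of each player. -/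
  Q : ∀ i, Set (EuclideanSpace ℝ (Fin (d i)))
  convex_Q : ∀ i, Convex ℝ (Q i)
  /-- The payoff density `φ s q c`. -/
  φ : S → Profile d → (I → ℝ) → ℝ
  φ_nonneg : ∀ s, ∀ q ∈ Set.univ.pi Q, ∀ c, 0 ≤ φ s q c
  φ_measurable : ∀ s, ∀ q ∈ Set.univ.pi Q, Measurable (φ s q)
  φ_integral : ∀ s, ∀ q ∈ Set.univ.pi Q, ∫⁻ c, ENNReal.ofReal (φ s q c) = 1
  φ_mean : ∀ s, ∀ q ∈ Set.univ.pi Q, ∀ i, Integrable (fun c : I → ℝ => c i * φ s q c)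
  φ_continuous : ∀ s c, ContinuousOn (fun q => φ s q c) (Set.univ.pi Q)

namespace ParametricGame

variable {I S : Type*} [Fintype I] {d : I → ℕ}

/-- The set `Q = ∏ i, Q i` of feasible strategy profiles. -/
def profiles (G : ParametricGame I S d) : Set (Profile d) := Set.univ.pi G.Q

/-- The distribution on `I → ℝ` of the payoff vector under parameter `s` and profile `q`. -/
noncomputable def payoffLaw (G : ParametricGame I S d) (s : S) (q : Profile d) :
    Measure (I → ℝ) :=
  (volume : Measure (I → ℝ)).withDensity (fun c => ENNReal.ofReal (G.φ s q c))

/-- The average payoff `u_i^s(q)`: the mean of the `i`-th payoff. The payoff is this mean plus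
a zero-mean noise. -/
noncomputable def meanPayoff (G : ParametricGame I S d) (s : S) (i : I) (q : Profile d) : ℝ :=
  ∫ c : I → ℝ, c i * G.φ s q c

/-- Expected payoff of player `i` at profile `q` under the belief `θ`. -/
noncomputable def expectedPayoff [Fintype S] (G : ParametricGame I S d) (θ : S → ℝ) (i : I)
    (q : Profile d) : ℝ :=
  ∑ s, θ s * G.meanPayoff s i q

open Classical in
/-- The set `EQ(θ)` of (pure) Nash equilibria of the game with belief `θ`. -/
def equilibria [Fintype S] (G : ParametricGame I S d) (θ : S → ℝ) : Set (Profile d) :=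
  {q | q ∈ G.profiles ∧ ∀ i, ∀ x ∈ G.Q i,
    G.expectedPayoff θ i (Function.update q i x) ≤ G.expectedPayoff θ i q}

/-- Kullback-Leibler divergence of the payoff distribution under `s` from that under the true
parameter `sStar`, at the profile `q`. -/
noncomputable def payoffKL (G : ParametricGame I S d) (sStar s : S) (q : Profile d) : ℝ≥0∞ :=
  klDiv (G.payoffLaw sStar q) (G.payoffLaw s q)

/-- The set `S*(q)` of parameters that are payoff-equivalent to `sStar` at `q`. -/
def payoffEquivalent (G : ParametricGame I S d) (sStar : S) (q : Profile d) : Set S :=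
  {s | G.payoffKL sStar s q = 0}

/-- Bayes update of the belief `θ` after observing the payoffs `c` at the profile `q`. -/
noncomputable def bayesUpdate [Fintype S] (G : ParametricGame I S d) (θ : S → ℝ) (q : Profile d)
    (c : I → ℝ) : S → ℝ :=
  fun s => θ s * G.φ s q c / ∑ s', θ s' * G.φ s' q c

/-- Learning with equilibrium strategies along a sequence `c` of realized payoffs: the sequence
of states (belief, profile). Time is indexed from `0`, so that index `k` is step `k + 1` of the
dynamics; `a k i` is the stepsize of player `i`. -/
noncomputable def state [Fintype S] (G : ParametricGame I S d) (g : (S → ℝ) → Profile d)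
    (a : ℕ → I → ℝ) (θ₁ : S → ℝ) (q₁ : Profile d) (c : ℕ → I → ℝ) : ℕ → (S → ℝ) × Profile d
  | 0 => (θ₁, q₁)
  | k + 1 =>
    let θ := (state G g a θ₁ q₁ c k).1
    let q := (state G g a θ₁ q₁ c k).2
    let θ' := G.bayesUpdate θ q (c k)
    (θ', fun i => (1 - a k i) • q i + a k i • g θ' i)

/-- The belief (index `k` is step `k + 1`). -/
noncomputable def belief [Fintype S] (G : ParametricGame I S d) (g : (S → ℝ) → Profile d)
    (a : ℕ → I → ℝ) (θ₁ : S → ℝ) (q₁ : Profile d) (c : ℕ → I → ℝ) (k : ℕ) : S → ℝ :=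
  (G.state g a θ₁ q₁ c k).1

/-- The strategy profile (index `k` is step `k + 1`). -/
noncomputable def strategy [Fintype S] (G : ParametricGame I S d) (g : (S → ℝ) → Profile d)
    (a : ℕ → I → ℝ) (θ₁ : S → ℝ) (q₁ : Profile d) (c : ℕ → I → ℝ) (k : ℕ) : Profile d :=
  (G.state g a θ₁ q₁ c k).2

/-- The sigma-algebra generated by the payoffs `c 0, …, c (k - 1)`. -/
def history {Ω : Type*} (c : ℕ → Ω → I → ℝ) (k : ℕ) : MeasurableSpace Ω :=
  ⨆ j : Fin k, MeasurableSpace.comap (c j) inferInstance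

/-- The random payoffs `c` of the learning dynamics when the true parameter is `sStar`: given
the past payoffs, the payoff vector at time `k` has density `φ sStar q`, where `q` is the
strategy profile played at time `k`. -/
structure IsPayoffSequence [Fintype S] {Ω : Type*} [MeasurableSpace Ω] (G : ParametricGame I S d)
    (sStar : S) (g : (S → ℝ) → Profile d) (a : ℕ → I → ℝ) (θ₁ : S → ℝ) (q₁ : Profile d)
    (P : Measure Ω) (c : ℕ → Ω → I → ℝ) : Prop where
  measurable : ∀ k, Measurable (c k)
  condLaw : ∀ k, ∀ B : Set (I → ℝ), MeasurableSet B →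
    P[(c k ⁻¹' B).indicator (fun _ => (1 : ℝ)) | history c k] =ᵐ[P]
      fun ω => (G.payoffLaw sStar (G.strategy g a θ₁ q₁ (fun j => c j ω) k)).real B

/-- Near `q` in the set of feasible profiles, the true payoff distribution is absolutely
continuous with respect to the one under `s`, and some absolute moment of order greater than one
of the log-likelihood ratio is bounded. -/
def LocalLogMomentBound (G : ParametricGame I S d) (sStar s : S) (q : Profile d) : Prop :=
  ∃ p : ℝ, 1 < p ∧ ∃ C : ℝ≥0, ∀ᶠ q' in 𝓝[G.profiles] q,
    G.payoffLaw sStar q' ≪ G.payoffLaw s q' ∧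
    ∫⁻ c, ENNReal.ofReal (|Real.log (G.φ sStar q' c / G.φ s q' c)| ^ p)
      ∂(G.payoffLaw sStar q') ≤ C

end ParametricGame

/-! By Bayes' rule, `θ^k(s) / θ^k(s*)` is the prior ratio times the likelihood ratio `Λ_n(s) = ∏ φ^s
/ φ^{s*}` of the observed payoffs. Under the true law `Λ_n(s)` is a nonnegative supermartingale, so
it converges almost surely. Beliefs sum to one, so `θ^k(s*)` is the reciprocal of a convergent sum
with limit at least one; hence the belief converges and the limit charges `s*`. Continuity of `g`
and the vanishing products then force `q^k → g(θbar)`.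

Decay: for `0 < l < 1` the conditional mean of `(φ^s / φ^{s*})^l` is the Hellinger affinity `H_l` at
the current profile. So `Λ_n^l` divided by the product of the affinities, each raised by a small
`ε`, is again a supermartingale and stays bounded along a path. Fatou's lemma, applied to the
nonnegative gap in the weighted AM-GM inequality, gives two facts: `H_l` is upper semicontinuous in
the densities, and `(1 - H_l) / l` has liminf at least the divergence as `l → 0`, even if that is
infinite. Every rate below the divergence at `qbar` follows (`ae_eventually_prod_div_le`), and with
it the claim on the support of `θbar`.

The opposite bound is a strong law without identical distributions (`ae_eventually_sum_log_div_le`):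
the log-likelihood ratio is truncated at level `k + 1`, the centered series converges, Kronecker's
lemma averages it, and the moment of order `p > 1` controls truncation and conditional means.
Finite-time exclusion is a conditional Borel-Cantelli argument (`ae_exists_density_eq_zero`).

The limit profile is random, so each almost sure event is fixed first, from countably many
supermartingales, and only then is a limit of the path considered. -/

/-! ### Sequential sampling from a kernel -/

/-- If, conditionally on `m`, the variable `c` has law `κ q` for an `m`-measurable `q`, then the
variable `c` can be integrated out. -/
theorem lintegral_mul_of_condExp_indicator {Ω X Y : Type*} [MeasurableSpace X]
    [MeasurableSpace Y] {m m0 : MeasurableSpace Ω} (hm : m ≤ m0) {P : Measure Ω}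
    [IsFiniteMeasure P] {κ : Kernel X Y} [IsMarkovKernel κ] {q : Ω → X} (hq : Measurable[m] q)
    {c : Ω → Y} (hc : Measurable c)
    (h : ∀ B, MeasurableSet B → P[(c ⁻¹' B).indicator (fun _ => (1 : ℝ)) | m] =ᵐ[P]
      fun ω => (κ (q ω)).real B)
    {U : Ω → ℝ≥0∞} (hU : Measurable[m] U) {f : X × Y → ℝ≥0∞} (hf : Measurable f) :
    ∫⁻ ω, U ω * f (q ω, c ω) ∂P = ∫⁻ ω, U ω * ∫⁻ y, f (q ω, y) ∂κ (q ω) ∂P := by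
  have hV : Measurable[m] fun ω => (U ω, q ω) := hU.prodMk hq
  have hV0 : Measurable fun ω => (U ω, q ω) := hV.mono hm le_rfl
  -- The weight `U` is carried along with the parameter, so the claim becomes a disintegration of
  -- one joint law; rectangles determine that law, and on them it is the defining property of
  -- conditional expectation.
  have key : P.map (fun ω => ((U ω, q ω), c ω))
      = (P.map fun ω => (U ω, q ω)) ⊗ₘ (κ.comap Prod.snd measurable_snd) := by
    have : IsFiniteMeasure (P.map (fun ω => ((U ω, q ω), c ω))) :=
      Measure.isFiniteMeasure_map _ _
    refine Measure.ext_prod fun {A B} hA hB => ?_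
    rw [Measure.compProd_apply_prod hA hB, Measure.map_apply (hV0.prodMk hc) (hA.prod hB),
      setLIntegral_map hA (Kernel.measurable_coe _ hB) hV0]
    simp only [Kernel.comap_apply]
    have hAm : MeasurableSet[m] ((fun ω => (U ω, q ω)) ⁻¹' A) := hV hA
    have hint : Integrable ((c ⁻¹' B).indicator (fun _ => (1 : ℝ))) P :=
      (integrable_const 1).indicator (hc hB)
    have h1 := setIntegral_condExp hm hint hAm
    rw [setIntegral_congr_ae (g := fun ω => (κ (q ω)).real B) (hm _ hAm)
      ((h B hB).mono fun ω hω _ => hω), setIntegral_indicator (hc hB)] at h1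
    have h2 : ∫⁻ ω in (fun ω => (U ω, q ω)) ⁻¹' A, κ (q ω) B ∂P
        = ENNReal.ofReal (∫ ω in (fun ω => (U ω, q ω)) ⁻¹' A, (κ (q ω)).real B ∂P) := by
      rw [ofReal_integral_eq_lintegral_ofReal]
      · refine lintegral_congr fun ω => ?_
        simp [Measure.real]
      · refine Integrable.of_bound (C := 1) ?_ ?_
        · exact ((Kernel.measurable_coe κ hB).comp
            (hq.mono hm le_rfl)).ennreal_toReal.aestronglyMeasurable
        · refine ae_of_all _ fun ω => ?_
          rw [Real.norm_of_nonneg measureReal_nonneg]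
          exact measureReal_le_one
      · exact ae_of_all _ fun ω => measureReal_nonneg
    rw [h2, h1, setIntegral_const, smul_eq_mul, mul_one, Measure.real, ENNReal.ofReal_toReal]
    · rfl
    · exact measure_ne_top _ _
  have hF : Measurable fun z : (ℝ≥0∞ × X) × Y => z.1.1 * f (z.1.2, z.2) := by fun_prop
  calc ∫⁻ ω, U ω * f (q ω, c ω) ∂P
      = ∫⁻ z : (ℝ≥0∞ × X) × Y, z.1.1 * f (z.1.2, z.2)
          ∂P.map (fun ω => ((U ω, q ω), c ω)) := by
        rw [lintegral_map hF (hV0.prodMk hc)]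
    _ = _ := by
        rw [key, Measure.lintegral_compProd hF, lintegral_map hF.lintegral_kernel_prod_right' hV0]
        refine lintegral_congr fun ω => ?_
        rw [lintegral_const_mul]
        · rfl
        · fun_prop

theorem ae_mem_of_condExp_indicator {Ω X Y : Type*} [MeasurableSpace X]
    [MeasurableSpace Y] {m m0 : MeasurableSpace Ω} (hm : m ≤ m0) {P : Measure Ω}
    [IsFiniteMeasure P] {κ : Kernel X Y} [IsMarkovKernel κ] {q : Ω → X} (hq : Measurable[m] q)
    {c : Ω → Y} (hc : Measurable c)
    (h : ∀ B, MeasurableSet B → P[(c ⁻¹' B).indicator (fun _ => (1 : ℝ)) | m] =ᵐ[P]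
      fun ω => (κ (q ω)).real B)
    {s : Set (X × Y)} (hs : MeasurableSet s) (hp : ∀ x, ∀ᵐ y ∂κ x, (x, y) ∈ s) :
    ∀ᵐ ω ∂P, (q ω, c ω) ∈ s := by
  have hF : Measurable (sᶜ.indicator fun _ => (1 : ℝ≥0∞)) := measurable_const.indicator hs.compl
  have h1 := lintegral_mul_of_condExp_indicator hm hq hc h (U := fun _ => 1) measurable_const hF
  have h2 : ∀ x, ∫⁻ y, sᶜ.indicator (fun _ => (1 : ℝ≥0∞)) (x, y) ∂κ x = 0 := by
    intro x
    refine (lintegral_eq_zero_iff (hF.comp measurable_prodMk_left)).2 ?_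
    filter_upwards [hp x] with y hy
    simp [hy]
  simp only [h2, mul_zero, lintegral_zero, one_mul] at h1
  filter_upwards [(lintegral_eq_zero_iff
    (hF.comp ((hq.mono hm le_rfl).prodMk hc))).1 h1] with ω hω
  by_contra hns
  simp [hns] at hω

/-- The variables `c k` are drawn sequentially: conditionally on the past `ℱ k`, `c k` has law
`κ (q k)`, where the parameter `q k` is determined by the past. -/
structure SequentialSampling {Ω X Y : Type*} [MeasurableSpace X] [MeasurableSpace Y]
    {m0 : MeasurableSpace Ω} (P : Measure Ω) (ℱ : Filtration ℕ m0) (κ : Kernel X Y)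
    (q : ℕ → Ω → X) (c : ℕ → Ω → Y) : Prop where
  measurable_param : ∀ k, Measurable[ℱ k] (q k)
  measurable_sample : ∀ k, Measurable[ℱ (k + 1)] (c k)
  condLaw : ∀ k B, MeasurableSet B →
    P[(c k ⁻¹' B).indicator (fun _ => (1 : ℝ)) | ℱ k] =ᵐ[P] fun ω => (κ (q k ω)).real B

namespace SequentialSampling

variable {Ω X Y : Type*} [MeasurableSpace X] [MeasurableSpace Y] {m0 : MeasurableSpace Ω}
  {P : Measure Ω} [IsFiniteMeasure P] {ℱ : Filtration ℕ m0} {κ : Kernel X Y} [IsMarkovKernel κ]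
  {q : ℕ → Ω → X} {c : ℕ → Ω → Y}

theorem lintegral_mul (h : SequentialSampling P ℱ κ q c) (k : ℕ) {U : Ω → ℝ≥0∞}
    (hU : Measurable[ℱ k] U) {f : X × Y → ℝ≥0∞} (hf : Measurable f) :
    ∫⁻ ω, U ω * f (q k ω, c k ω) ∂P = ∫⁻ ω, U ω * ∫⁻ y, f (q k ω, y) ∂κ (q k ω) ∂P :=
  lintegral_mul_of_condExp_indicator (ℱ.le k) (h.measurable_param k)
    ((h.measurable_sample k).mono (ℱ.le _) le_rfl) (h.condLaw k) hU hf

theorem ae_of_forall_ae (h : SequentialSampling P ℱ κ q c) {s : Set (X × Y)}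
    (hs : MeasurableSet s) (hp : ∀ x, ∀ᵐ y ∂κ x, (x, y) ∈ s) :
    ∀ᵐ ω ∂P, ∀ k, (q k ω, c k ω) ∈ s :=
  ae_all_iff.2 fun k => ae_mem_of_condExp_indicator (ℱ.le k) (h.measurable_param k)
    ((h.measurable_sample k).mono (ℱ.le _) le_rfl) (h.condLaw k) hs hp

/-- A product of nonnegative factors whose conditional means are at most one is a nonnegative
supermartingale, and so converges. -/
theorem ae_tendsto_prod (h : SequentialSampling P ℱ κ q c) {f : ℕ → X → Y → ℝ}
    (hf : ∀ k, Measurable (Function.uncurry (f k))) (hf0 : ∀ k x y, 0 ≤ f k x y)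
    (hf1 : ∀ k x, ∫⁻ y, ENNReal.ofReal (f k x y) ∂κ x ≤ 1) :
    ∀ᵐ ω ∂P, ∃ L, Tendsto (fun n => ∏ k ∈ Finset.range n, f k (q k ω) (c k ω)) atTop (𝓝 L) := by
  set M : ℕ → Ω → ℝ := fun n ω => ∏ k ∈ Finset.range n, f k (q k ω) (c k ω) with hM
  have hM0 : ∀ n ω, 0 ≤ M n ω := fun n ω => Finset.prod_nonneg fun k _ => hf0 _ _ _
  have hMm : ∀ n, Measurable[ℱ n] (M n) := by
    intro n
    refine Finset.measurable_fun_prod _ fun k hk => ?_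
    have hk : k + 1 ≤ n := Finset.mem_range.1 hk
    exact (hf k).comp (((h.measurable_param k).mono (ℱ.mono (by omega)) le_rfl).prodMk
      ((h.measurable_sample k).mono (ℱ.mono hk) le_rfl))
  have hMm0 : ∀ n, Measurable (M n) := fun n => (hMm n).mono (ℱ.le _) le_rfl
  have step : ∀ n (s : Set Ω), MeasurableSet[ℱ n] s →
      ∫⁻ ω in s, ENNReal.ofReal (M (n + 1) ω) ∂P ≤ ∫⁻ ω in s, ENNReal.ofReal (M n ω) ∂P := by
    intro n s hs
    have hs0 : MeasurableSet s := ℱ.le n s hs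
    have hU : Measurable[ℱ n] (s.indicator fun ω => ENNReal.ofReal (M n ω)) :=
      Measurable.indicator (hMm n).ennreal_ofReal hs
    have h1 := h.lintegral_mul n hU (f := fun z => ENNReal.ofReal (f n z.1 z.2))
      (hf n).ennreal_ofReal
    calc ∫⁻ ω in s, ENNReal.ofReal (M (n + 1) ω) ∂P
        = ∫⁻ ω, s.indicator (fun ω => ENNReal.ofReal (M n ω)) ω
            * ENNReal.ofReal (f n (q n ω) (c n ω)) ∂P := by
          rw [← lintegral_indicator hs0]
          refine lintegral_congr fun ω => ?_
          by_cases hω : ω ∈ s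
          · simp only [hω, Set.indicator_of_mem, hM]
            rw [Finset.prod_range_succ, ENNReal.ofReal_mul (hM0 n ω)]
          · simp [hω]
      _ ≤ ∫⁻ ω, s.indicator (fun ω => ENNReal.ofReal (M n ω)) ω * 1 ∂P := by
          rw [h1]
          exact lintegral_mono fun ω => mul_le_mul_right (hf1 n _) _
      _ = _ := by simp only [mul_one]; rw [lintegral_indicator hs0]
  have hbd : ∀ n, ∫⁻ ω, ENNReal.ofReal (M n ω) ∂P ≤ P Set.univ := by
    intro n
    induction n with
    | zero => simp [hM]
    | succ n ih =>
      have := step n Set.univ MeasurableSet.univ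
      simp only [Measure.restrict_univ] at this
      exact this.trans ih
  have hint : ∀ n, Integrable (M n) P := by
    intro n
    refine ⟨(hMm0 n).aestronglyMeasurable, ?_⟩
    rw [hasFiniteIntegral_iff_ofReal (ae_of_all _ (hM0 n))]
    exact (hbd n).trans_lt (measure_lt_top _ _)
  have hsup : Supermartingale M ℱ P := by
    refine supermartingale_of_setIntegral_succ_le (fun n => (hMm n).stronglyMeasurable) hint
      fun n s hs => ?_
    rw [integral_eq_lintegral_of_nonneg_ae (ae_of_all _ (hM0 _))
      (hMm0 _).aestronglyMeasurable.restrict,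
      integral_eq_lintegral_of_nonneg_ae (ae_of_all _ (hM0 _))
      (hMm0 _).aestronglyMeasurable.restrict]
    refine ENNReal.toReal_mono ?_ (step n s hs)
    exact ((setLIntegral_le_lintegral _ _).trans_lt
      ((hbd n).trans_lt (measure_lt_top _ _))).ne
  -- The convergence theorem is for `L¹`-bounded submartingales, hence the sign; nonnegativity turns
  -- the mean bound into an `L¹` bound.
  have hconv := hsup.neg.exists_ae_tendsto_of_bdd (R := (P Set.univ).toNNReal) fun n => by
    rw [eLpNorm_one_eq_lintegral_enorm, ENNReal.coe_toNNReal (measure_ne_top _ _)]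
    refine le_trans (le_of_eq (lintegral_congr fun ω => ?_)) (hbd n)
    rw [Pi.neg_apply, Pi.neg_apply, enorm_neg, Real.enorm_of_nonneg (hM0 n ω)]
  filter_upwards [hconv] with ω ⟨L, hL⟩
  exact ⟨-L, by simpa using hL.neg⟩

theorem measurable_integral_param {f : X → Y → ℝ} (hf : Measurable (Function.uncurry f)) :
    Measurable fun x => ∫ y, f x y ∂κ x := by
  have := hf.stronglyMeasurable.integral_kernel_prod_right (κ := κ)
  exact this.measurable

/-- Bounded exponential factors, normalized by their conditional means. -/
theorem ae_tendsto_prod_exp_div (h : SequentialSampling P ℱ κ q c) {f : ℕ → X → Y → ℝ}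
    (hf : ∀ k, Measurable (Function.uncurry (f k))) (hf1 : ∀ k x y, |f k x y| ≤ 1) :
    ∀ᵐ ω ∂P, ∃ L, Tendsto (fun n => ∏ k ∈ Finset.range n,
      (Real.exp (f k (q k ω) (c k ω)) / ∫ y, Real.exp (f k (q k ω) y) ∂κ (q k ω)))
      atTop (𝓝 L) := by
  have hm : ∀ k, Measurable (Function.uncurry fun x y => Real.exp (f k x y)) := fun k =>
    (hf k).exp
  have hint : ∀ k x, Integrable (fun y => Real.exp (f k x y)) (κ x) := fun k x =>
    Integrable.of_bound (C := Real.exp 1)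
      ((hm k).comp measurable_prodMk_left).aestronglyMeasurable
      (ae_of_all _ fun y => by
        rw [Real.norm_of_nonneg (Real.exp_pos _).le]
        exact Real.exp_le_exp.2 (abs_le.1 (hf1 k x y)).2)
  refine h.ae_tendsto_prod
    (f := fun k x y => Real.exp (f k x y) / ∫ y, Real.exp (f k x y) ∂κ x) ?_ ?_ ?_
  · intro k
    exact (hm k).div ((measurable_integral_param (hm k)).comp measurable_fst)
  · intro k x y
    exact div_nonneg (Real.exp_pos _).le (integral_nonneg fun _ => (Real.exp_pos _).le)
  · intro k x
    rw [← ofReal_integral_eq_lintegral_ofReal ((hint k x).div_const _)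
      (ae_of_all _ fun y => div_nonneg (Real.exp_pos _).le
        (integral_nonneg fun _ => (Real.exp_pos _).le)), integral_div]
    exact ENNReal.ofReal_le_one.2 (div_self_le_one _)

/-- Jensen's inequality gives the lower bound; `exp t ≤ 1 + t + t ^ 2` for `|t| ≤ 1` and `log x ≤ x
- 1` give the upper one. -/
theorem log_integral_exp_sub_integral_mem {ν : Measure Y} [IsProbabilityMeasure ν] {f : Y → ℝ}
    (hf : Measurable f) (hf1 : ∀ y, |f y| ≤ 1) :
    0 ≤ Real.log (∫ y, Real.exp (f y) ∂ν) - ∫ y, f y ∂ν ∧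
      Real.log (∫ y, Real.exp (f y) ∂ν) - ∫ y, f y ∂ν ≤ ∫ y, f y ^ 2 ∂ν := by
  have hi : Integrable f ν := Integrable.of_bound (C := 1) hf.aestronglyMeasurable
    (ae_of_all _ hf1)
  have hi2 : Integrable (fun y => f y ^ 2) ν :=
    Integrable.of_bound (C := 1) (hf.pow_const 2).aestronglyMeasurable
      (ae_of_all _ fun y => by
        rw [Real.norm_of_nonneg (sq_nonneg _), ← sq_abs]
        exact pow_le_one₀ (abs_nonneg _) (hf1 y))
  have hie : Integrable (fun y => Real.exp (f y)) ν :=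
    Integrable.of_bound (C := Real.exp 1) hf.exp.aestronglyMeasurable
      (ae_of_all _ fun y => by
        rw [Real.norm_of_nonneg (Real.exp_pos _).le]
        exact Real.exp_le_exp.2 (abs_le.1 (hf1 y)).2)
  have hj : Real.exp (∫ y, f y ∂ν) ≤ ∫ y, Real.exp (f y) ∂ν :=
    convexOn_exp.map_integral_le Real.continuous_exp.continuousOn isClosed_univ
      (ae_of_all _ fun _ => Set.mem_univ _) hi hie
  have hpos : 0 < ∫ y, Real.exp (f y) ∂ν := (Real.exp_pos _).trans_le hj
  constructor
  · rw [sub_nonneg, Real.le_log_iff_exp_le hpos]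
    exact hj
  · have h1 : ∫ y, Real.exp (f y) ∂ν ≤ ∫ y, (1 + f y + f y ^ 2) ∂ν := by
      refine integral_mono hie (((integrable_const 1).add hi).add hi2) fun y => ?_
      have := (abs_le.1 (Real.abs_exp_sub_one_sub_id_le (hf1 y))).2
      simp only
      linarith
    have e : ∫ y, (1 + f y + f y ^ 2) ∂ν = 1 + ∫ y, f y ∂ν + ∫ y, f y ^ 2 ∂ν := by
      have hi1 : Integrable (fun y => 1 + f y) ν := (integrable_const 1).add hi
      rw [integral_add hi1 hi2, integral_add (integrable_const 1) hi]
      simp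
    have := Real.log_le_sub_one_of_pos hpos
    linarith

/-- A sum of bounded terms, centered at their conditional means, converges wherever the
conditional second moments are summable. -/
theorem ae_tendsto_sum_sub_integral (h : SequentialSampling P ℱ κ q c) {f : ℕ → X → Y → ℝ}
    (hf : ∀ k, Measurable (Function.uncurry (f k))) (hf1 : ∀ k x y, |f k x y| ≤ 1) :
    ∀ᵐ ω ∂P, (Summable fun k => ∫ y, f k (q k ω) y ^ 2 ∂κ (q k ω)) →
      ∃ L, Tendsto (fun n => ∑ k ∈ Finset.range n,
        (f k (q k ω) (c k ω) - ∫ y, f k (q k ω) y ∂κ (q k ω))) atTop (𝓝 L) := by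
  filter_upwards [h.ae_tendsto_prod_exp_div hf hf1,
    h.ae_tendsto_prod_exp_div (f := fun k x y => -f k x y) (fun k => (hf k).neg)
      (fun k x y => by rw [abs_neg]; exact hf1 k x y)] with ω ⟨A, hA⟩ ⟨B, hB⟩ hs

  have hm : ∀ k, Measurable fun y => f k (q k ω) y := fun k =>
    (hf k).comp measurable_prodMk_left
  set m : ℕ → ℝ := fun k => ∫ y, f k (q k ω) y ∂κ (q k ω) with hmdef
  -- `α` and `β` are the compensators turning the normalized products for `f` and `-f` into `exp W`
  -- and `exp (-W)`; both are nonnegative and at most the conditional second moments, so their sums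
  -- converge.
  set α : ℕ → ℝ := fun k => Real.log (∫ y, Real.exp (f k (q k ω) y) ∂κ (q k ω)) - m k with hα
  set β : ℕ → ℝ := fun k => Real.log (∫ y, Real.exp (-f k (q k ω) y) ∂κ (q k ω)) + m k with hβ
  set W : ℕ → ℝ := fun n => ∑ k ∈ Finset.range n, (f k (q k ω) (c k ω) - m k) with hW
  have hpos : ∀ (k : ℕ) (g : Y → ℝ), Measurable g → (∀ y, |g y| ≤ 1) →
      0 < ∫ y, Real.exp (g y) ∂κ (q k ω) := fun k g hg hg1 =>
    integral_exp_pos (Integrable.of_bound (C := Real.exp 1) hg.exp.aestronglyMeasurable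
      (ae_of_all _ fun y => by
        rw [Real.norm_of_nonneg (Real.exp_pos _).le]
        exact Real.exp_le_exp.2 (abs_le.1 (hg1 y)).2))
  have hα' := fun k => log_integral_exp_sub_integral_mem (ν := κ (q k ω)) (hm k) (hf1 k _)
  have hβ' := fun k => log_integral_exp_sub_integral_mem (ν := κ (q k ω)) (hm k).neg
    (fun y => by rw [Pi.neg_apply, abs_neg]; exact hf1 k _ y)
  simp only [Pi.neg_apply, integral_neg, sub_neg_eq_add, even_two.neg_pow] at hβ'
  obtain ⟨a, ha⟩ : ∃ a, Tendsto (fun n => ∑ k ∈ Finset.range n, α k) atTop (𝓝 a) :=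
    ⟨_, (Summable.of_nonneg_of_le (fun k => (hα' k).1)
      (fun k => (hα' k).2) hs).hasSum.tendsto_sum_nat⟩
  obtain ⟨b, hb⟩ : ∃ b, Tendsto (fun n => ∑ k ∈ Finset.range n, β k) atTop (𝓝 b) :=
    ⟨_, (Summable.of_nonneg_of_le (fun k => (hβ' k).1)
      (fun k => (hβ' k).2) hs).hasSum.tendsto_sum_nat⟩
  have eA : ∀ n, Real.exp (W n) = (∏ k ∈ Finset.range n, (Real.exp (f k (q k ω) (c k ω)) /
      ∫ y, Real.exp (f k (q k ω) y) ∂κ (q k ω))) * Real.exp (∑ k ∈ Finset.range n, α k) := by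
    intro n
    rw [hW, Real.exp_sum, Real.exp_sum, ← Finset.prod_mul_distrib]
    refine Finset.prod_congr rfl fun k _ => ?_
    rw [hα, Real.exp_sub, Real.exp_sub, Real.exp_log (hpos k _ (hm k) (hf1 k _))]
    field_simp [(hpos k _ (hm k) (hf1 k _)).ne']
  have eB : ∀ n, Real.exp (-W n) = (∏ k ∈ Finset.range n, (Real.exp (-f k (q k ω) (c k ω)) /
      ∫ y, Real.exp (-f k (q k ω) y) ∂κ (q k ω))) *
        Real.exp (∑ k ∈ Finset.range n, β k) := by
    intro n
    rw [hW, ← Finset.sum_neg_distrib, Real.exp_sum, Real.exp_sum, ← Finset.prod_mul_distrib]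
    refine Finset.prod_congr rfl fun k _ => ?_
    have hp := hpos k _ (hm k).neg (fun y => by rw [Pi.neg_apply, abs_neg]; exact hf1 k _ y)
    simp only [Pi.neg_apply] at hp
    rw [hβ, neg_sub, Real.exp_sub, Real.exp_add, Real.exp_log hp, Real.exp_neg]
    field_simp [hp.ne']
  have tA : Tendsto (fun n => Real.exp (W n)) atTop (𝓝 (A * Real.exp a)) := by
    simp only [eA]
    exact hA.mul ((Real.continuous_exp.tendsto _).comp ha)
  have tB : Tendsto (fun n => Real.exp (-W n)) atTop (𝓝 (B * Real.exp b)) := by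
    simp only [eB]
    exact hB.mul ((Real.continuous_exp.tendsto _).comp hb)
  -- `exp W` and `exp (-W)` both converge and their product is one, so neither limit is zero and the
  -- logarithm can be taken.
  have hne : A * Real.exp a ≠ 0 := by
    intro h0
    have h1 := tA.mul tB
    simp only [← Real.exp_add, add_neg_cancel, Real.exp_zero, h0, zero_mul] at h1
    exact one_ne_zero (tendsto_nhds_unique tendsto_const_nhds h1)
  exact ⟨Real.log (A * Real.exp a), ((Real.continuousAt_log hne).tendsto.comp tA).congr
    fun n => Real.log_exp (W n)⟩

end SequentialSampling

/-! ### Probability densities, Hellinger affinities and Kullback-Leibler divergence -/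

/-- A probability density with respect to `μ`. -/
structure IsProbDensity {Y : Type*} [MeasurableSpace Y] (μ : Measure Y) (a : Y → ℝ) : Prop where
  measurable : Measurable a
  nonneg : ∀ y, 0 ≤ a y
  lintegral_eq : ∫⁻ y, ENNReal.ofReal (a y) ∂μ = 1

/-- The measure with density `a`. -/
noncomputable def densityLaw {Y : Type*} [MeasurableSpace Y] (μ : Measure Y) (a : Y → ℝ) :
    Measure Y :=
  μ.withDensity fun y => ENNReal.ofReal (a y)

/-- The Hellinger affinity of order `l`. -/
noncomputable def hellingerAffinity {Y : Type*} [MeasurableSpace Y] (μ : Measure Y) (l : ℝ)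
    (a b : Y → ℝ) : ℝ :=
  ∫ y, a y ^ (1 - l) * b y ^ l ∂μ

theorem eventually_lt_of_ofReal_le_liminf {u : ℕ → ℝ} (hu : ∀ n, 0 ≤ u n) {x y : ℝ}
    (h : ENNReal.ofReal x ≤ liminf (fun n => ENNReal.ofReal (u n)) atTop) (hy : y < x) :
    ∀ᶠ n in atTop, y < u n := by
  rcases lt_or_ge y 0 with h0 | h0
  · exact Eventually.of_forall fun n => h0.trans_le (hu n)
  · have : ENNReal.ofReal y < liminf (fun n => ENNReal.ofReal (u n)) atTop :=
      ((ENNReal.ofReal_lt_ofReal_iff_of_nonneg h0).2 hy).trans_le h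
    filter_upwards [eventually_lt_of_lt_liminf this] with n hn
    exact (ENNReal.ofReal_lt_ofReal_iff_of_nonneg h0).1 hn

section Density

variable {Y : Type*} [MeasurableSpace Y] {μ : Measure Y} {a b : Y → ℝ}

namespace IsProbDensity

theorem integrable (ha : IsProbDensity μ a) : Integrable a μ := by
  refine ⟨ha.measurable.aestronglyMeasurable, ?_⟩
  rw [hasFiniteIntegral_iff_ofReal (ae_of_all _ ha.nonneg), ha.lintegral_eq]
  exact ENNReal.one_lt_top

theorem integral_eq (ha : IsProbDensity μ a) : ∫ y, a y ∂μ = 1 := by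
  rw [integral_eq_lintegral_of_nonneg_ae (ae_of_all _ ha.nonneg)
    ha.measurable.aestronglyMeasurable, ha.lintegral_eq, ENNReal.toReal_one]

theorem isProbabilityMeasure (ha : IsProbDensity μ a) : IsProbabilityMeasure (densityLaw μ a) :=
  ⟨by rw [densityLaw, withDensity_apply _ MeasurableSet.univ, Measure.restrict_univ,
    ha.lintegral_eq]⟩

theorem lintegral_law (ha : IsProbDensity μ a) {f : Y → ℝ≥0∞} (hf : Measurable f) :
    ∫⁻ y, f y ∂densityLaw μ a = ∫⁻ y, ENNReal.ofReal (a y) * f y ∂μ :=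
  lintegral_withDensity_eq_lintegral_mul _ ha.measurable.ennreal_ofReal hf

theorem ae_law_iff (ha : IsProbDensity μ a) {p : Y → Prop} :
    (∀ᵐ y ∂densityLaw μ a, p y) ↔ ∀ᵐ y ∂μ, a y ≠ 0 → p y := by
  rw [densityLaw, ae_withDensity_iff' ha.measurable.ennreal_ofReal.aemeasurable]
  refine eventually_congr (ae_of_all _ fun y => ?_)
  rw [ne_eq, ENNReal.ofReal_eq_zero, not_le, (ha.nonneg y).lt_iff_ne']

theorem ae_law_pos (ha : IsProbDensity μ a) : ∀ᵐ y ∂densityLaw μ a, 0 < a y := by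
  rw [ha.ae_law_iff]
  exact ae_of_all _ fun y hy => (ha.nonneg y).lt_of_ne' hy

theorem absolutelyContinuous_iff (ha : IsProbDensity μ a) (hb : IsProbDensity μ b) :
    densityLaw μ a ≪ densityLaw μ b ↔ ∀ᵐ y ∂μ, b y = 0 → a y = 0 := by
  constructor
  · intro h
    filter_upwards [ha.ae_law_iff.1 (h.ae_le hb.ae_law_pos)] with y hy hby
    by_contra hne
    exact (hy hne).ne' hby
  · intro h
    refine Measure.AbsolutelyContinuous.mk fun s hs h0 => ?_
    rw [measure_eq_zero_iff_ae_notMem] at h0 ⊢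
    rw [ha.ae_law_iff]
    filter_upwards [h, hb.ae_law_iff.1 h0] with y hy hy2 hay
    exact hy2 fun hb0 => hay (hy hb0)

theorem rnDeriv_law [SigmaFinite μ] (ha : IsProbDensity μ a) (hb : IsProbDensity μ b)
    (hab : densityLaw μ a ≪ densityLaw μ b) :
    (densityLaw μ a).rnDeriv (densityLaw μ b) =ᵐ[densityLaw μ b]
      fun y => ENNReal.ofReal (a y / b y) := by
  have := hb.isProbabilityMeasure
  have hm : Measurable fun y => ENNReal.ofReal (a y / b y) :=
    (ha.measurable.div hb.measurable).ennreal_ofReal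
  have e : densityLaw μ a = (densityLaw μ b).withDensity fun y => ENNReal.ofReal (a y / b y) := by
    rw [densityLaw, densityLaw, ← withDensity_mul _ hb.measurable.ennreal_ofReal hm]
    refine withDensity_congr_ae ?_
    filter_upwards [(ha.absolutelyContinuous_iff hb).1 hab] with y hy
    rw [Pi.mul_apply, ← ENNReal.ofReal_mul (hb.nonneg y)]
    by_cases h0 : b y = 0
    · simp [h0, hy h0]
    · rw [mul_div_cancel₀ _ h0]
  have := Measure.rnDeriv_withDensity (densityLaw μ b) hm
  rwa [← e] at this

/-- In this form the integrand is nonnegative and vanishes where `b` does, as the comparison by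
Fatou's lemma requires. -/
theorem klDiv_law [SigmaFinite μ] (ha : IsProbDensity μ a) (hb : IsProbDensity μ b)
    (hab : densityLaw μ a ≪ densityLaw μ b) :
    klDiv (densityLaw μ a) (densityLaw μ b)
      = ∫⁻ y, ENNReal.ofReal (b y * klFun (a y / b y)) ∂μ := by
  have := hb.isProbabilityMeasure
  have := ha.isProbabilityMeasure
  have hm : Measurable fun y => ENNReal.ofReal (klFun (a y / b y)) :=
    (measurable_klFun.comp (ha.measurable.div hb.measurable)).ennreal_ofReal
  rw [klDiv_eq_lintegral_klFun, if_pos hab]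
  calc _ = ∫⁻ y, ENNReal.ofReal (klFun (a y / b y)) ∂densityLaw μ b := by
        refine lintegral_congr_ae ?_
        filter_upwards [ha.rnDeriv_law hb hab] with y hy
        rw [hy, ENNReal.toReal_ofReal (div_nonneg (ha.nonneg y) (hb.nonneg y))]
    _ = _ := by
        rw [hb.lintegral_law hm]
        exact lintegral_congr fun y => (ENNReal.ofReal_mul (hb.nonneg y)).symm

theorem toReal_klDiv_law [SigmaFinite μ] (ha : IsProbDensity μ a) (hb : IsProbDensity μ b)
    (hab : densityLaw μ a ≪ densityLaw μ b) :
    (klDiv (densityLaw μ a) (densityLaw μ b)).toReal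
      = ∫ y, Real.log (a y / b y) ∂densityLaw μ a := by
  have := hb.isProbabilityMeasure
  have := ha.isProbabilityMeasure
  rw [toReal_klDiv_of_measure_eq hab (by simp)]
  refine integral_congr_ae ?_
  filter_upwards [hab.ae_le (ha.rnDeriv_law hb hab)] with y hy
  rw [llr, hy, ENNReal.toReal_ofReal (div_nonneg (ha.nonneg y) (hb.nonneg y))]

theorem measurable_rpow_mul_rpow (ha : IsProbDensity μ a) (hb : IsProbDensity μ b) (l : ℝ) :
    Measurable fun y => a y ^ (1 - l) * b y ^ l :=
  (ha.measurable.pow_const _).mul (hb.measurable.pow_const _)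

theorem rpow_mul_rpow_le (ha : IsProbDensity μ a) (hb : IsProbDensity μ b) {l : ℝ}
    (hl0 : 0 < l) (hl1 : l < 1) (y : Y) :
    a y ^ (1 - l) * b y ^ l ≤ (1 - l) * a y + l * b y :=
  Real.geom_mean_le_arith_mean2_weighted (by linarith) hl0.le (ha.nonneg y) (hb.nonneg y)
    (by ring)

theorem integrable_rpow_mul_rpow (ha : IsProbDensity μ a) (hb : IsProbDensity μ b) {l : ℝ}
    (hl0 : 0 < l) (hl1 : l < 1) : Integrable (fun y => a y ^ (1 - l) * b y ^ l) μ := by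
  refine ((ha.integrable.const_mul (1 - l)).add (hb.integrable.const_mul l)).mono'
    (ha.measurable_rpow_mul_rpow hb l).aestronglyMeasurable (ae_of_all _ fun y => ?_)
  rw [Real.norm_of_nonneg (mul_nonneg (Real.rpow_nonneg (ha.nonneg y) _)
    (Real.rpow_nonneg (hb.nonneg y) _))]
  exact ha.rpow_mul_rpow_le hb hl0 hl1 y

theorem hellingerAffinity_nonneg (ha : IsProbDensity μ a) (hb : IsProbDensity μ b) (l : ℝ) :
    0 ≤ hellingerAffinity μ l a b :=
  integral_nonneg fun y => mul_nonneg (Real.rpow_nonneg (ha.nonneg y) _)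
    (Real.rpow_nonneg (hb.nonneg y) _)

theorem integrable_gap (ha : IsProbDensity μ a) (hb : IsProbDensity μ b) {l : ℝ}
    (hl0 : 0 < l) (hl1 : l < 1) :
    Integrable (fun y => (1 - l) * a y + l * b y - a y ^ (1 - l) * b y ^ l) μ :=
  ((ha.integrable.const_mul _).add (hb.integrable.const_mul _)).sub
    (ha.integrable_rpow_mul_rpow hb hl0 hl1)

/-- One minus the affinity is thus the integral of a nonnegative function, to which Fatou's lemma
applies without any domination. -/
theorem integral_gap (ha : IsProbDensity μ a) (hb : IsProbDensity μ b) {l : ℝ}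
    (hl0 : 0 < l) (hl1 : l < 1) :
    ∫ y, ((1 - l) * a y + l * b y - a y ^ (1 - l) * b y ^ l) ∂μ
      = 1 - hellingerAffinity μ l a b := by
  have h1 : Integrable (fun y => (1 - l) * a y + l * b y) μ :=
    (ha.integrable.const_mul _).add (hb.integrable.const_mul _)
  rw [integral_sub h1 (ha.integrable_rpow_mul_rpow hb hl0 hl1),
    integral_add (ha.integrable.const_mul _) (hb.integrable.const_mul _), integral_const_mul,
    integral_const_mul, ha.integral_eq, hb.integral_eq, hellingerAffinity]
  ring

theorem hellingerAffinity_le_one (ha : IsProbDensity μ a) (hb : IsProbDensity μ b) {l : ℝ}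
    (hl0 : 0 < l) (hl1 : l < 1) : hellingerAffinity μ l a b ≤ 1 := by
  have := integral_nonneg (μ := μ) fun y => sub_nonneg.2 (ha.rpow_mul_rpow_le hb hl0 hl1 y)
  rw [ha.integral_gap hb hl0 hl1] at this
  linarith

/-- The Hellinger affinity is upper semicontinuous for pointwise convergence of densities. -/
theorem eventually_hellingerAffinity_lt (ha : IsProbDensity μ a) (hb : IsProbDensity μ b)
    {u v : ℕ → Y → ℝ} (hu : ∀ n, IsProbDensity μ (u n)) (hv : ∀ n, IsProbDensity μ (v n))
    (hua : ∀ y, Tendsto (fun n => u n y) atTop (𝓝 (a y)))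
    (hvb : ∀ y, Tendsto (fun n => v n y) atTop (𝓝 (b y)))
    {l : ℝ} (hl0 : 0 < l) (hl1 : l < 1) {δ : ℝ} (hδ : hellingerAffinity μ l a b < δ) :
    ∀ᶠ n in atTop, hellingerAffinity μ l (u n) (v n) < δ := by
  have key : ENNReal.ofReal (1 - hellingerAffinity μ l a b) ≤
      liminf (fun n => ENNReal.ofReal (1 - hellingerAffinity μ l (u n) (v n))) atTop := by
    calc ENNReal.ofReal (1 - hellingerAffinity μ l a b)
        = ∫⁻ y, liminf (fun n => ENNReal.ofReal ((1 - l) * u n y + l * v n y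
            - u n y ^ (1 - l) * v n y ^ l)) atTop ∂μ := by
          rw [← ha.integral_gap hb hl0 hl1, ofReal_integral_eq_lintegral_ofReal
            (ha.integrable_gap hb hl0 hl1)
            (ae_of_all _ fun y => sub_nonneg.2 (ha.rpow_mul_rpow_le hb hl0 hl1 y))]
          refine lintegral_congr fun y => (Tendsto.liminf_eq ?_).symm
          refine ENNReal.tendsto_ofReal ?_
          exact (((hua y).const_mul _).add ((hvb y).const_mul _)).sub
            (((hua y).rpow_const (Or.inr (by linarith))).mul
              ((hvb y).rpow_const (Or.inr hl0.le)))
      _ ≤ liminf (fun n => ∫⁻ y, ENNReal.ofReal ((1 - l) * u n y + l * v n y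
            - u n y ^ (1 - l) * v n y ^ l) ∂μ) atTop := by
          refine lintegral_liminf_le fun n => Measurable.ennreal_ofReal ?_
          exact (((hu n).measurable.const_mul _).add ((hv n).measurable.const_mul _)).sub
            ((hu n).measurable_rpow_mul_rpow (hv n) l)
      _ = _ := by
          congr 1
          funext n
          rw [← (hu n).integral_gap (hv n) hl0 hl1, ofReal_integral_eq_lintegral_ofReal
            ((hu n).integrable_gap (hv n) hl0 hl1)
            (ae_of_all _ fun y => sub_nonneg.2 ((hu n).rpow_mul_rpow_le (hv n) hl0 hl1 y))]
  filter_upwards [eventually_lt_of_ofReal_le_liminf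
    (fun n => sub_nonneg.2 ((hu n).hellingerAffinity_le_one (hv n) hl0 hl1)) key
    (y := 1 - δ) (by linarith)] with n hn
  linarith

end IsProbDensity

/-- For `x > 0` the quotient contains the difference quotient of `t ↦ (y / x) ^ t` at zero. For `x =
0` it is constantly `y`, in agreement with `klFun 0 = 1`. -/
theorem tendsto_gap_div {x y : ℝ} (hx : 0 ≤ x) (hy : 0 < y) {l : ℕ → ℝ} (hl : ∀ n, 0 < l n)
    (hl1 : ∀ n, l n < 1) (hl0 : Tendsto l atTop (𝓝 0)) :
    Tendsto (fun n => ((1 - l n) * x + l n * y - x ^ (1 - l n) * y ^ l n) / l n) atTop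
      (𝓝 (y * klFun (x / y))) := by
  rcases hx.eq_or_lt with rfl | hx
  · refine tendsto_const_nhds.congr fun n => ?_
    rw [Real.zero_rpow (by linarith [hl1 n])]
    rw [zero_div, klFun_zero]
    field_simp [(hl n).ne']
    ring
  · have hd : HasDerivAt (fun t : ℝ => (y / x) ^ t) (Real.log (y / x)) 0 := by
      simpa using (Real.hasStrictDerivAt_const_rpow (div_pos hy hx) 0).hasDerivAt
    have hs := (hasDerivAt_iff_tendsto_slope.1 hd).comp
      (tendsto_nhdsWithin_iff.2 ⟨hl0, Eventually.of_forall fun n => (hl n).ne'⟩)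
    have e : y * klFun (x / y) = (y - x) - x * Real.log (y / x) := by
      rw [klFun, Real.log_div hx.ne' hy.ne', Real.log_div hy.ne' hx.ne']
      field_simp
      ring
    rw [e]
    refine (tendsto_const_nhds.sub (hs.const_mul x)).congr fun n => ?_
    have h1 : x ^ (1 - l n) * y ^ l n = x * (y / x) ^ l n := by
      rw [Real.rpow_sub hx, Real.rpow_one, Real.div_rpow hy.le hx.le]
      ring
    rw [Function.comp, slope_def_field, h1, Real.rpow_zero, sub_zero]
    field_simp [(hl n).ne']
    ring

/-- This blow-up on `{b = 0 < a}` is how a bounded gap detects absolute continuity. -/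
theorem tendsto_gap_div_atTop {x : ℝ} (hx : 0 < x) {l : ℕ → ℝ} (hl : ∀ n, 0 < l n)
    (hl0 : Tendsto l atTop (𝓝 0)) :
    Tendsto (fun n => ((1 - l n) * x + l n * 0 - x ^ (1 - l n) * 0 ^ l n) / l n) atTop atTop := by
  have h1 : Tendsto (fun n => (l n)⁻¹) atTop atTop :=
    (tendsto_nhdsWithin_iff.2 ⟨hl0, Eventually.of_forall hl⟩).inv_tendsto_nhdsGT_zero
  have h2 : Tendsto (fun n => (1 - l n) * x) atTop (𝓝 x) := by
    simpa using (hl0.const_sub 1).mul_const x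
  refine (h2.pos_mul_atTop hx h1).congr fun n => ?_
  rw [Real.zero_rpow (hl n).ne']
  ring

namespace IsProbDensity

/-- Every rate below the divergence is seen by the Hellinger affinity of some small order. -/
theorem exists_hellingerAffinity_lt [SigmaFinite μ] (ha : IsProbDensity μ a)
    (hb : IsProbDensity μ b) {l : ℕ → ℝ} (hl : ∀ n, 0 < l n) (hl1 : ∀ n, l n < 1)
    (hl0 : Tendsto l atTop (𝓝 0)) {r : ℝ}
    (hr : ENNReal.ofReal r < klDiv (densityLaw μ a) (densityLaw μ b)) :
    ∃ n, hellingerAffinity μ (l n) a b < Real.exp (-(r * l n)) := by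
  -- Otherwise `1 - H_l ≤ 1 - exp (-(r * l)) ≤ r * l` along the whole sequence, so the gaps divided
  -- by `l` have integrals at most `r`, and Fatou's lemma bounds the divergence by `r`.
  by_contra! hcon
  set F : ℕ → Y → ℝ≥0∞ := fun n y => ENNReal.ofReal
    (((1 - l n) * a y + l n * b y - a y ^ (1 - l n) * b y ^ l n) / l n) with hF
  have hFm : ∀ n, Measurable (F n) := fun n => Measurable.ennreal_ofReal
    ((((ha.measurable.const_mul _).add (hb.measurable.const_mul _)).sub
      (ha.measurable_rpow_mul_rpow hb (l n))).div_const _)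
  have hFi : ∀ n, ∫⁻ y, F n y ∂μ ≤ ENNReal.ofReal r := by
    intro n
    rw [hF, ← ofReal_integral_eq_lintegral_ofReal
      ((ha.integrable_gap hb (hl n) (hl1 n)).div_const _) (ae_of_all _ fun y =>
        div_nonneg (sub_nonneg.2 (ha.rpow_mul_rpow_le hb (hl n) (hl1 n) y)) (hl n).le),
      integral_div, ha.integral_gap hb (hl n) (hl1 n)]
    refine ENNReal.ofReal_le_ofReal ?_
    rw [div_le_iff₀ (hl n)]
    have := hcon n
    have := Real.add_one_le_exp (-(r * l n))
    linarith
  have hfat : ∫⁻ y, liminf (fun n => F n y) atTop ∂μ ≤ ENNReal.ofReal r :=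
    (lintegral_liminf_le hFm).trans
      (liminf_le_of_le (by isBoundedDefault) fun c hc => by
        obtain ⟨n, hn⟩ := hc.exists
        exact hn.trans (hFi n))
  have hab : densityLaw μ a ≪ densityLaw μ b := by
    rw [ha.absolutelyContinuous_iff hb]
    have hfin : ∀ᵐ y ∂μ, liminf (fun n => F n y) atTop < ∞ :=
      ae_lt_top (Measurable.liminf hFm) (hfat.trans_lt ENNReal.ofReal_lt_top).ne
    filter_upwards [hfin] with y hy h0
    by_contra hne
    have hpos : 0 < a y := (ha.nonneg y).lt_of_ne' hne
    have := ENNReal.tendsto_ofReal_atTop.comp (tendsto_gap_div_atTop hpos hl hl0)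
    rw [← h0] at this
    exact hy.ne this.liminf_eq
  refine absurd (hr.trans_le ?_) (lt_irrefl _)
  refine le_trans ?_ hfat
  rw [ha.klDiv_law hb hab]
  refine lintegral_mono fun y => ?_
  rcases (hb.nonneg y).eq_or_lt with h0 | h0
  · simp [← h0]
  · exact (ENNReal.tendsto_ofReal (tendsto_gap_div (ha.nonneg y) h0 hl hl1 hl0)).liminf_eq.ge

end IsProbDensity

end Density

/-! ### Means of truncated log-likelihood ratios -/

theorem max_neg_min_mem {N K : ℝ} (hN : 0 ≤ N) (hK : 0 ≤ K) (x : ℝ) :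
    -N ≤ max (-N) (min K x) ∧ max (-N) (min K x) ≤ K :=
  ⟨le_max_left _ _, max_le (by linarith) (min_le_left _ _)⟩

theorem abs_max_neg_min_le {N K : ℝ} (hN : 0 ≤ N) (hK : 0 ≤ K) (x : ℝ) :
    |max (-N) (min K x)| ≤ N + K := by
  obtain ⟨h1, h2⟩ := max_neg_min_mem hN hK x
  exact abs_le.2 ⟨by linarith, by linarith⟩

/-- Only `x > K` matters, where `x ≤ x * (x / K) ^ (p - 1) = K ^ (1 - p) * x ^ p`. Raising the upper
level from `K` to a large `N` thus costs little in mean, uniformly under a moment bound. -/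
theorem max_neg_min_le_add_rpow {N K p : ℝ} (hK : 0 < K) (hp : 1 < p) (x : ℝ) :
    max (-N) (min N x) ≤ max (-N) (min K x) + K ^ (1 - p) * |x| ^ p := by
  have hnn : 0 ≤ K ^ (1 - p) * |x| ^ p :=
    mul_nonneg (Real.rpow_nonneg hK.le _) (Real.rpow_nonneg (abs_nonneg _) _)
  rcases le_or_gt x K with h | h
  · have : max (-N) (min N x) ≤ max (-N) (min K x) := by
      rw [min_eq_right h]
      exact max_le_max le_rfl (min_le_right _ _)
    linarith
  · have hx : 0 < x := hK.trans h
    have h1 : x ≤ K ^ (1 - p) * |x| ^ p := by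
      rw [abs_of_pos hx]
      have h2 : 1 ≤ (x / K) ^ (p - 1) :=
        Real.one_le_rpow ((one_le_div hK).2 h.le) (by linarith)
      have h3 : K ^ (1 - p) * x ^ p = x * (x / K) ^ (p - 1) := by
        rw [Real.div_rpow hx.le hK.le, show 1 - p = -(p - 1) by ring, Real.rpow_neg hK.le,
          Real.rpow_sub_one hx.ne']
        field_simp
      rw [h3]
      nlinarith
    refine max_le ?_ ?_
    · exact (le_max_left _ _).trans (by linarith)
    · rw [min_eq_left h.le]
      exact (min_le_right _ _).trans (h1.trans (by linarith [le_max_right (-N) K]))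

section Density

variable {Y : Type*} [MeasurableSpace Y] {μ : Measure Y} {a b : Y → ℝ}

namespace IsProbDensity

theorem integrable_truncation (ha : IsProbDensity μ a) {f : Y → ℝ} (hf : Measurable f)
    {N K : ℝ} (hN : 0 ≤ N) (hK : 0 ≤ K) :
    Integrable (fun y => max (-N) (min K (f y))) (densityLaw μ a) := by
  have := ha.isProbabilityMeasure
  exact Integrable.of_bound (C := N + K)
    (measurable_const.max (measurable_const.min hf)).aestronglyMeasurable
    (ae_of_all _ fun y => abs_max_neg_min_le hN hK _)

theorem ofReal_sub_integral (ha : IsProbDensity μ a) {f : Y → ℝ} (hf : Measurable f)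
    (hfi : Integrable f (densityLaw μ a)) {K : ℝ} (hK : ∀ y, f y ≤ K) :
    ENNReal.ofReal (K - ∫ y, f y ∂densityLaw μ a)
      = ∫⁻ y, ENNReal.ofReal (a y) * ENNReal.ofReal (K - f y) ∂μ := by
  have := ha.isProbabilityMeasure
  have hi : Integrable (fun y => K - f y) (densityLaw μ a) := (integrable_const K).sub hfi
  rw [← ha.lintegral_law (hf.const_sub K).ennreal_ofReal,
    ← ofReal_integral_eq_lintegral_ofReal hi (ae_of_all _ fun y => sub_nonneg.2 (hK y)),
    integral_sub (integrable_const K) hfi]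
  simp

/-- With the upper level `K` fixed, `K` minus the truncation is nonnegative, and Fatou's lemma gives
the one-sided bound while the lower level tends to `-∞`. -/
theorem eventually_integral_truncation_le (ha : IsProbDensity μ a) (hb : IsProbDensity μ b)
    {u v : ℕ → Y → ℝ} (hu : ∀ n, IsProbDensity μ (u n)) (hv : ∀ n, IsProbDensity μ (v n))
    (hua : ∀ y, Tendsto (fun n => u n y) atTop (𝓝 (a y)))
    (hvb : ∀ y, Tendsto (fun n => v n y) atTop (𝓝 (b y)))
    (hab : densityLaw μ a ≪ densityLaw μ b)
    (hint : Integrable (fun y => Real.log (a y / b y)) (densityLaw μ a))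
    {N : ℕ → ℝ} (hN : Tendsto N atTop atTop) (hN0 : ∀ n, 0 ≤ N n) {K : ℝ} (hK : 0 ≤ K)
    {ε : ℝ} (hε : 0 < ε) :
    ∀ᶠ n in atTop, ∫ y, max (-N n) (min K (Real.log (u n y / v n y))) ∂densityLaw μ (u n)
      ≤ ∫ y, Real.log (a y / b y) ∂densityLaw μ a + ε := by
  have := ha.isProbabilityMeasure
  have := fun n => (hu n).isProbabilityMeasure
  set D := ∫ y, Real.log (a y / b y) ∂densityLaw μ a with hD
  have hX : ∀ n, Measurable fun y => Real.log (u n y / v n y) := fun n =>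
    ((hu n).measurable.div (hv n).measurable).log
  have hX0 : Measurable fun y => Real.log (a y / b y) := (ha.measurable.div hb.measurable).log
  have hG : ∀ n, Measurable fun y =>
      ENNReal.ofReal (K - max (-N n) (min K (Real.log (u n y / v n y)))) := fun n =>
    (measurable_const.sub (measurable_const.max (measurable_const.min (hX n)))).ennreal_ofReal
  have hti := fun n => (hu n).integrable_truncation (hX n) (hN0 n) hK
  have hmi : Integrable (fun y => min K (Real.log (a y / b y))) (densityLaw μ a) :=
    (integrable_const K).inf hint
  have key : ENNReal.ofReal (K - ∫ y, min K (Real.log (a y / b y)) ∂densityLaw μ a) ≤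
      liminf (fun n => ENNReal.ofReal (K - ∫ y, max (-N n) (min K (Real.log (u n y / v n y)))
        ∂densityLaw μ (u n))) atTop := by
    have e1 := ha.ofReal_sub_integral (measurable_const.min hX0) hmi fun y => min_le_left _ _
    have e2 := fun n => (hu n).ofReal_sub_integral
      (measurable_const.max (measurable_const.min (hX n))) (hti n)
      fun y => (max_neg_min_mem (hN0 n) hK _).2
    simp only [e1, e2]
    refine le_trans (lintegral_mono_ae ?_) (lintegral_liminf_le fun n =>
      (hu n).measurable.ennreal_ofReal.mul (hG n))
    filter_upwards [(ha.absolutelyContinuous_iff hb).1 hab] with y hy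
    rcases (ha.nonneg y).eq_or_lt with h0 | h0
    · simp [← h0]
    · have hb0 : b y ≠ 0 := fun h => h0.ne' (hy h)
      have hlog : Tendsto (fun n => min K (Real.log (u n y / v n y))) atTop
          (𝓝 (min K (Real.log (a y / b y)))) :=
        tendsto_const_nhds.min (((hua y).div (hvb y) hb0).log (div_ne_zero h0.ne' hb0))
      have hmax : Tendsto (fun n => max (-N n) (min K (Real.log (u n y / v n y)))) atTop
          (𝓝 (min K (Real.log (a y / b y)))) := by
        refine hlog.congr' ?_
        filter_upwards [hlog.eventually (lt_mem_nhds (sub_one_lt _)),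
          hN.eventually_ge_atTop (1 - min K (Real.log (a y / b y)))] with n h1 h2
        rw [max_eq_right]
        linarith
      refine (Tendsto.liminf_eq ?_).ge
      exact ENNReal.Tendsto.mul (ENNReal.tendsto_ofReal (hua y)) (Or.inr ENNReal.ofReal_ne_top)
        (ENNReal.tendsto_ofReal (tendsto_const_nhds.sub hmax)) (Or.inr ENNReal.ofReal_ne_top)
  have hmin : ∫ y, min K (Real.log (a y / b y)) ∂densityLaw μ a ≤ D :=
    integral_mono hmi hint fun y => min_le_right _ _
  have hnn : ∀ n, 0 ≤ K - ∫ y, max (-N n) (min K (Real.log (u n y / v n y)))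
      ∂densityLaw μ (u n) := by
    intro n
    have h1 := integral_mono (hti n) (integrable_const K)
      fun y => (max_neg_min_mem (hN0 n) hK (Real.log (u n y / v n y))).2
    simp only [integral_const, probReal_univ, one_smul] at h1
    linarith
  filter_upwards [eventually_lt_of_ofReal_le_liminf hnn key (y := K - D - ε) (by linarith)]
    with n hn
  linarith

/-- Under a bounded moment of order greater than one, the means of the log-likelihood ratio,
truncated at levels tending to infinity, are asymptotically at most the mean at the limit. -/
theorem eventually_integral_truncated_log_le (ha : IsProbDensity μ a) (hb : IsProbDensity μ b)
    {u v : ℕ → Y → ℝ} (hu : ∀ n, IsProbDensity μ (u n)) (hv : ∀ n, IsProbDensity μ (v n))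
    (hua : ∀ y, Tendsto (fun n => u n y) atTop (𝓝 (a y)))
    (hvb : ∀ y, Tendsto (fun n => v n y) atTop (𝓝 (b y)))
    (hab : densityLaw μ a ≪ densityLaw μ b)
    (hint : Integrable (fun y => Real.log (a y / b y)) (densityLaw μ a))
    {p : ℝ} (hp : 1 < p) {C : ℝ≥0} (hC : ∀ᶠ n in atTop,
      ∫⁻ y, ENNReal.ofReal (|Real.log (u n y / v n y)| ^ p) ∂densityLaw μ (u n) ≤ C)
    {N : ℕ → ℝ} (hN : Tendsto N atTop atTop) (hN0 : ∀ n, 0 ≤ N n) {ε : ℝ} (hε : 0 < ε) :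
    ∀ᶠ n in atTop, ∫ y, max (-N n) (min (N n) (Real.log (u n y / v n y))) ∂densityLaw μ (u n)
      ≤ ∫ y, Real.log (a y / b y) ∂densityLaw μ a + ε := by
  -- Since `1 - p < 0`, a large `K` makes the cost of the moving upper level less than `ε / 2`.
  obtain ⟨K, hKε, hK⟩ : ∃ K : ℝ, K ^ (1 - p) * C < ε / 2 ∧ 0 < K := by
    have h1 : Tendsto (fun K : ℝ => K ^ (1 - p) * C) atTop (𝓝 0) := by
      have := (tendsto_rpow_neg_atTop (y := p - 1) (by linarith)).mul_const (C : ℝ)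
      simpa using this
    exact ((h1.eventually (gt_mem_nhds (half_pos hε))).and (eventually_gt_atTop 0)).exists
  filter_upwards [hC, ha.eventually_integral_truncation_le hb hu hv hua hvb hab hint hN hN0 hK.le
    (half_pos hε)] with n hn1 hn2
  have := (hu n).isProbabilityMeasure
  have hX : Measurable fun y => Real.log (u n y / v n y) :=
    ((hu n).measurable.div (hv n).measurable).log
  have hXm : Measurable fun y => |Real.log (u n y / v n y)| ^ p := hX.abs.pow_const p
  have hX0 : ∀ y, 0 ≤ |Real.log (u n y / v n y)| ^ p := fun y =>
    Real.rpow_nonneg (abs_nonneg _) _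
  have hXi : Integrable (fun y => |Real.log (u n y / v n y)| ^ p) (densityLaw μ (u n)) := by
    refine ⟨hXm.aestronglyMeasurable, ?_⟩
    rw [hasFiniteIntegral_iff_ofReal (ae_of_all _ hX0)]
    exact hn1.trans_lt ENNReal.coe_lt_top
  have hXC : ∫ y, |Real.log (u n y / v n y)| ^ p ∂densityLaw μ (u n) ≤ C := by
    rw [integral_eq_lintegral_of_nonneg_ae (ae_of_all _ hX0) hXm.aestronglyMeasurable]
    exact ENNReal.toReal_le_coe_of_le_coe hn1
  have h3 := integral_mono ((hu n).integrable_truncation hX (hN0 n) (hN0 n))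
    (((hu n).integrable_truncation hX (hN0 n) hK.le).add (hXi.const_mul (K ^ (1 - p))))
    fun y => max_neg_min_le_add_rpow hK hp _
  simp only [Pi.add_apply] at h3
  rw [integral_add ((hu n).integrable_truncation hX (hN0 n) hK.le) (hXi.const_mul _),
    integral_const_mul] at h3
  have h4 := mul_le_mul_of_nonneg_left hXC (Real.rpow_nonneg hK.le (1 - p))
  linarith

end IsProbDensity

end Density

/-! ### Averages and products of sequences -/

/-- The Cesàro means of `max (w k) B`, which equals `B` from some index on, tend to `B`; the gap up
to `B'` absorbs the initial terms. -/
theorem eventually_sum_range_le {w : ℕ → ℝ} {B B' : ℝ} (h : ∀ᶠ k in atTop, w k ≤ B)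
    (hB : B < B') : ∀ᶠ n : ℕ in atTop, ∑ k ∈ Finset.range n, w k ≤ n * B' := by
  have h1 : Tendsto (fun k => max (w k) B) atTop (𝓝 B) :=
    tendsto_const_nhds.congr' (h.mono fun k hk => (max_eq_right hk).symm)
  filter_upwards [h1.cesaro.eventually (gt_mem_nhds hB), eventually_gt_atTop 0] with n hn hn0
  have hn0' : (0 : ℝ) < n := by exact_mod_cast hn0
  rw [inv_mul_lt_iff₀ hn0'] at hn
  exact (Finset.sum_le_sum fun k _ => le_max_left (w k) B).trans hn.le

theorem eventually_prod_range_le_pow {v : ℕ → ℝ} (hv : ∀ k, 0 < v k) {δ δ' : ℝ} (hδ0 : 0 < δ)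
    (h : ∀ᶠ k in atTop, v k ≤ δ) (hδ : δ < δ') :
    ∀ᶠ n : ℕ in atTop, ∏ k ∈ Finset.range n, v k ≤ δ' ^ n := by
  filter_upwards [eventually_sum_range_le (h.mono fun k hk => Real.log_le_log (hv k) hk)
    (Real.log_lt_log hδ0 hδ)] with n hn
  have hp : 0 < ∏ k ∈ Finset.range n, v k := Finset.prod_pos fun k _ => hv k
  have hp' : 0 < δ' ^ n := pow_pos (hδ0.trans hδ) n
  rw [← Real.log_le_log_iff hp hp', Real.log_prod fun k _ => (hv k).ne', Real.log_pow]
  exact hn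

/-- Kronecker's lemma for the weights `k + 1`. -/
theorem tendsto_inv_mul_sum_succ_mul {x : ℕ → ℝ} {L : ℝ}
    (h : Tendsto (fun n => ∑ k ∈ Finset.range n, x k) atTop (𝓝 L)) :
    Tendsto (fun n : ℕ => (n : ℝ)⁻¹ * ∑ k ∈ Finset.range n, ((k : ℝ) + 1) * x k) atTop (𝓝 0) := by
  -- Summation by parts; after division by `n` both terms tend to `L`.
  have e : ∀ n : ℕ, ∑ k ∈ Finset.range n, ((k : ℝ) + 1) * x k
      = n * ∑ k ∈ Finset.range n, x k - ∑ k ∈ Finset.range n, ∑ j ∈ Finset.range k, x j := by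
    intro n
    induction n with
    | zero => simp
    | succ n ih =>
      rw [Finset.sum_range_succ, ih, Finset.sum_range_succ x, Finset.sum_range_succ _ n]
      push_cast
      ring
  have h1 := h.sub h.cesaro
  rw [sub_self] at h1
  refine h1.congr' ?_
  filter_upwards [eventually_gt_atTop 0] with n hn
  have : (n : ℝ) ≠ 0 := by exact_mod_cast hn.ne'
  rw [e]
  field_simp

/-- The exponent `min p 2` is at most `2`, so that `t ^ 2 ≤ |t| ^ r`, at most `p`, so that the
moment controls `|x| ^ r`, and above `1`, so that the bound is summable for `M = k + 1`. -/
theorem sq_le_one_add_rpow_mul {t x M p : ℝ} (hM : 0 < M) (hp : 1 < p) (ht : |t| ≤ 1)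
    (htx : |t| ≤ |x| / M) : t ^ 2 ≤ (1 + |x| ^ p) * M ^ (-min p 2) := by
  set r := min p 2 with hr
  have hr0 : 0 < r := lt_min (by linarith) (by norm_num)
  have h1 : t ^ 2 ≤ |t| ^ r := by
    rw [← sq_abs, ← Real.rpow_natCast]
    rcases (abs_nonneg t).eq_or_lt with h0 | h0
    · rw [← h0, Real.zero_rpow hr0.ne']
      simp
    · exact Real.rpow_le_rpow_of_exponent_ge h0 ht (by simp [hr])
  have h2 : |t| ^ r ≤ |x| ^ r * M ^ (-r) := by
    refine (Real.rpow_le_rpow (abs_nonneg t) htx hr0.le).trans_eq ?_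
    rw [Real.div_rpow (abs_nonneg x) hM.le, Real.rpow_neg hM.le, div_eq_mul_inv]
  have h3 : |x| ^ r ≤ 1 + |x| ^ p := by
    rcases le_total |x| 1 with h | h
    · have := Real.rpow_le_one (abs_nonneg x) h hr0.le
      have := Real.rpow_nonneg (abs_nonneg x) p
      linarith
    · have := Real.rpow_le_rpow_of_exponent_le h (min_le_left p 2)
      linarith
  exact h1.trans (h2.trans (mul_le_mul_of_nonneg_right h3 (Real.rpow_nonneg hM.le _)))

/-! ### Likelihood ratios along sequential samples -/

/-- A family of probability densities depending continuously on a parameter. -/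
structure IsContinuousDensityFamily {X Y : Type*} [TopologicalSpace X] [MeasurableSpace Y]
    (μ : Measure Y) (a : X → Y → ℝ) : Prop where
  isProbDensity : ∀ x, IsProbDensity μ (a x)
  continuous : ∀ y, Continuous fun x => a x y

section LikelihoodRatio

variable {Ω X Y : Type*} [TopologicalSpace X] [TopologicalSpace.MetrizableSpace X]
  [SecondCountableTopology X] [MeasurableSpace X] [BorelSpace X] [MeasurableSpace Y]
  {μ : Measure Y} {a b : X → Y → ℝ}
  {m0 : MeasurableSpace Ω} {P : Measure Ω} [IsFiniteMeasure P] {ℱ : Filtration ℕ m0}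
  {κ : Kernel X Y} [IsMarkovKernel κ] {q : ℕ → Ω → X} {c : ℕ → Ω → Y}

theorem IsContinuousDensityFamily.measurable_uncurry (ha : IsContinuousDensityFamily μ a) :
    Measurable (Function.uncurry a) :=
  measurable_uncurry_of_continuous_of_measurable ha.continuous
    fun x => (ha.isProbDensity x).measurable

theorem IsContinuousDensityFamily.measurable_hellingerAffinity [SFinite μ]
    (ha : IsContinuousDensityFamily μ a) (hb : IsContinuousDensityFamily μ b) (l : ℝ) :
    Measurable fun x => hellingerAffinity μ l (a x) (b x) := by
  have : StronglyMeasurable (Function.uncurry fun x y => a x y ^ (1 - l) * b x y ^ l) :=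
    ((ha.measurable_uncurry.pow_const _).mul
      (hb.measurable_uncurry.pow_const _)).stronglyMeasurable
  exact this.integral_prod_right.measurable

namespace SequentialSampling

theorem ae_density_pos (h : SequentialSampling P ℱ κ q c)
    (ha : IsContinuousDensityFamily μ a) (hκ : ∀ x, κ x = densityLaw μ (a x)) :
    ∀ᵐ ω ∂P, ∀ k, 0 < a (q k ω) (c k ω) :=
  h.ae_of_forall_ae (s := {z | 0 < a z.1 z.2})
    (measurableSet_lt measurable_const ha.measurable_uncurry) fun x => by
      rw [hκ]
      exact (ha.isProbDensity x).ae_law_pos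

/-- The conditional mean of `b / a` is the `b`-mass of `{a ≠ 0}`, which is at most one and can be
smaller. -/
theorem ae_tendsto_prod_div (h : SequentialSampling P ℱ κ q c)
    (ha : IsContinuousDensityFamily μ a) (hb : IsContinuousDensityFamily μ b)
    (hκ : ∀ x, κ x = densityLaw μ (a x)) :
    ∀ᵐ ω ∂P, ∃ L, Tendsto (fun n => ∏ k ∈ Finset.range n,
      b (q k ω) (c k ω) / a (q k ω) (c k ω)) atTop (𝓝 L) := by
  have hm : Measurable (Function.uncurry fun x y => b x y / a x y) :=
    hb.measurable_uncurry.div ha.measurable_uncurry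
  refine h.ae_tendsto_prod (f := fun _ x y => b x y / a x y) (fun _ => hm)
    (fun _ x y => div_nonneg ((hb.isProbDensity x).nonneg y) ((ha.isProbDensity x).nonneg y))
    fun _ x => ?_
  have hmx : Measurable fun y => ENNReal.ofReal (b x y / a x y) :=
    (hm.comp measurable_prodMk_left).ennreal_ofReal
  rw [hκ, (ha.isProbDensity x).lintegral_law hmx, ← (hb.isProbDensity x).lintegral_eq]
  refine lintegral_mono fun y => ?_
  rw [← ENNReal.ofReal_mul ((ha.isProbDensity x).nonneg y)]
  refine ENNReal.ofReal_le_ofReal ?_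
  by_cases h0 : a x y = 0
  · simpa [h0] using (hb.isProbDensity x).nonneg y
  · rw [mul_div_cancel₀ _ h0]

/-- The affinity is the conditional mean of the power; adding `ε` keeps the normalizer positive when
the two laws are singular. -/
theorem ae_tendsto_prod_rpow_div [SFinite μ] (h : SequentialSampling P ℱ κ q c)
    (ha : IsContinuousDensityFamily μ a) (hb : IsContinuousDensityFamily μ b)
    (hκ : ∀ x, κ x = densityLaw μ (a x)) {l : ℝ} (hl0 : 0 < l) (hl1 : l < 1) {ε : ℝ}
    (hε : 0 < ε) :
    ∀ᵐ ω ∂P, ∃ L, Tendsto (fun n => ∏ k ∈ Finset.range n,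
      ((b (q k ω) (c k ω) / a (q k ω) (c k ω)) ^ l /
        (hellingerAffinity μ l (a (q k ω)) (b (q k ω)) + ε))) atTop (𝓝 L) := by
  have hpos : ∀ x, 0 < hellingerAffinity μ l (a x) (b x) + ε := fun x =>
    add_pos_of_nonneg_of_pos
      ((ha.isProbDensity x).hellingerAffinity_nonneg (hb.isProbDensity x) l) hε
  have hnn : ∀ x y, 0 ≤ (b x y / a x y) ^ l := fun x y =>
    Real.rpow_nonneg (div_nonneg ((hb.isProbDensity x).nonneg y) ((ha.isProbDensity x).nonneg y)) _
  have hm : Measurable (Function.uncurry fun x y => (b x y / a x y) ^ l) :=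
    (hb.measurable_uncurry.div ha.measurable_uncurry).pow_const _
  have hm' : Measurable (Function.uncurry fun x y => (b x y / a x y) ^ l /
      (hellingerAffinity μ l (a x) (b x) + ε)) :=
    hm.div (((ha.measurable_hellingerAffinity hb l).comp measurable_fst).add_const _)
  refine h.ae_tendsto_prod (f := fun _ x y => (b x y / a x y) ^ l /
    (hellingerAffinity μ l (a x) (b x) + ε)) (fun _ => hm')
    (fun _ x y => div_nonneg (hnn x y) (hpos x).le) fun _ x => ?_
  have hmx : Measurable fun y => ENNReal.ofReal ((b x y / a x y) ^ l /
      (hellingerAffinity μ l (a x) (b x) + ε)) :=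
    (hm'.comp measurable_prodMk_left).ennreal_ofReal
  rw [hκ, (ha.isProbDensity x).lintegral_law hmx]
  calc _ = ∫⁻ y, ENNReal.ofReal (a x y ^ (1 - l) * b x y ^ l /
          (hellingerAffinity μ l (a x) (b x) + ε)) ∂μ := by
        refine lintegral_congr fun y => ?_
        have ha0 := (ha.isProbDensity x).nonneg y
        rw [← ENNReal.ofReal_mul ha0]
        congr 1
        rcases ha0.eq_or_lt with h0 | h0
        · rw [← h0, Real.zero_rpow (by linarith)]
          simp
        · rw [Real.div_rpow ((hb.isProbDensity x).nonneg y) ha0, Real.rpow_sub h0, Real.rpow_one]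
          ring
    _ ≤ 1 := by
        rw [← ofReal_integral_eq_lintegral_ofReal
          (((ha.isProbDensity x).integrable_rpow_mul_rpow (hb.isProbDensity x) hl0 hl1).div_const _)
          (ae_of_all _ fun y => div_nonneg (mul_nonneg
            (Real.rpow_nonneg ((ha.isProbDensity x).nonneg y) _)
            (Real.rpow_nonneg ((hb.isProbDensity x).nonneg y) _)) (hpos x).le), integral_div,
          ENNReal.ofReal_le_one, div_le_one (hpos x)]
        exact le_add_of_nonneg_right hε.le

/-- The likelihood ratio decays exponentially at every rate below the divergence at the limit of
the parameters. -/
theorem ae_eventually_prod_div_le [SigmaFinite μ] (h : SequentialSampling P ℱ κ q c)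
    (ha : IsContinuousDensityFamily μ a) (hb : IsContinuousDensityFamily μ b)
    (hκ : ∀ x, κ x = densityLaw μ (a x)) :
    ∀ᵐ ω ∂P, ∀ x, Tendsto (fun k => q k ω) atTop (𝓝 x) → ∀ r : ℝ,
      ENNReal.ofReal r < klDiv (densityLaw μ (a x)) (densityLaw μ (b x)) →
      ∀ᶠ n : ℕ in atTop, ∏ k ∈ Finset.range n, b (q k ω) (c k ω) / a (q k ω) (c k ω)
        ≤ Real.exp (-(r * n)) := by
  -- Countably many orders `l i` and slacks `1 / (j + 1)` yield one null set, valid for every limit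
  -- `x` and rate `r`.
  set l : ℕ → ℝ := fun n => 1 / ((n + 1 : ℕ) + 1 : ℝ) with hl
  have hl0 : ∀ n, 0 < l n := fun n => Nat.one_div_pos_of_nat
  have hl1 : ∀ n, l n < 1 := fun n => by
    rw [hl, div_lt_one (by positivity)]
    push_cast
    linarith [(Nat.cast_nonneg n : (0 : ℝ) ≤ n)]
  have hlt : Tendsto l atTop (𝓝 0) :=
    (tendsto_one_div_add_atTop_nhds_zero_nat (𝕜 := ℝ)).comp (tendsto_add_atTop_nat 1)
  have hae : ∀ᵐ ω ∂P, ∀ i j : ℕ, ∃ L, Tendsto (fun n => ∏ k ∈ Finset.range n,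
      ((b (q k ω) (c k ω) / a (q k ω) (c k ω)) ^ l i /
        (hellingerAffinity μ (l i) (a (q k ω)) (b (q k ω)) + 1 / ((j : ℝ) + 1)))) atTop (𝓝 L) := by
    rw [ae_all_iff]
    intro i
    rw [ae_all_iff]
    intro j
    exact h.ae_tendsto_prod_rpow_div ha hb hκ (hl0 i) (hl1 i) Nat.one_div_pos_of_nat
  filter_upwards [hae] with ω hω x hx r hr
  have hnn : ∀ k, 0 ≤ b (q k ω) (c k ω) / a (q k ω) (c k ω) := fun k =>
    div_nonneg ((hb.isProbDensity _).nonneg _) ((ha.isProbDensity _).nonneg _)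
  obtain ⟨i, hi⟩ := (ha.isProbDensity x).exists_hellingerAffinity_lt (hb.isProbDensity x)
    hl0 hl1 hlt hr
  obtain ⟨j, hj⟩ := exists_nat_one_div_lt (half_pos (sub_pos.2 hi))
  set ε : ℝ := 1 / ((j : ℝ) + 1) with hε
  have hε0 : 0 < ε := Nat.one_div_pos_of_nat
  obtain ⟨L, hL⟩ := hω i j
  set v : ℕ → ℝ := fun k => hellingerAffinity μ (l i) (a (q k ω)) (b (q k ω)) + ε with hv
  have haff : ∀ y, 0 ≤ hellingerAffinity μ (l i) (a y) (b y) := fun y =>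
    (ha.isProbDensity y).hellingerAffinity_nonneg (hb.isProbDensity y) _
  have hv0 : ∀ k, 0 < v k := fun k => add_pos_of_nonneg_of_pos (haff _) hε0
  -- One `ε` is in the normalizer, the other pays for semicontinuity along the path; `2 * ε` is
  -- still below the gap to `exp (-(r * l i))`.
  set δ := hellingerAffinity μ (l i) (a x) (b x) + 2 * ε with hδ
  have hδ0 : 0 < δ := by
    have := haff x
    positivity
  have hδe : δ < Real.exp (-(r * l i)) := by linarith
  obtain ⟨δ', hδ', hδ'e⟩ := exists_between hδe
  have hvδ : ∀ᶠ k in atTop, v k ≤ δ := by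
    filter_upwards [(ha.isProbDensity x).eventually_hellingerAffinity_lt (hb.isProbDensity x)
      (fun k => ha.isProbDensity (q k ω)) (fun k => hb.isProbDensity (q k ω))
      (fun y => ((ha.continuous y).tendsto x).comp hx)
      (fun y => ((hb.continuous y).tendsto x).comp hx) (hl0 i) (hl1 i)
      (lt_add_of_pos_right _ hε0)] with k hk
    simp only [hv, hδ]
    linarith
  have hpow : Tendsto (fun n : ℕ => (L + 1) * (δ' / Real.exp (-(r * l i))) ^ n) atTop (𝓝 0) := by
    have := (tendsto_pow_atTop_nhds_zero_of_lt_one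
      (div_nonneg (hδ0.trans hδ').le (Real.exp_pos _).le)
      ((div_lt_one (Real.exp_pos _)).2 hδ'e)).const_mul (L + 1)
    rwa [mul_zero] at this
  filter_upwards [eventually_prod_range_le_pow hv0 hδ0 hvδ hδ',
    hL.eventually (gt_mem_nhds (lt_add_one L)), hpow.eventually (gt_mem_nhds one_pos)]
    with n h1 h2 h3
  have hvp : 0 < ∏ k ∈ Finset.range n, v k := Finset.prod_pos fun k _ => hv0 k
  have hL1 : 0 ≤ L + 1 := (Finset.prod_nonneg fun k _ => div_nonneg
    (Real.rpow_nonneg (hnn k) _) (hv0 k).le).trans h2.le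
  rw [Finset.prod_div_distrib, div_lt_iff₀ hvp, Real.finsetProd_rpow _ _ fun k _ => hnn k] at h2
  have h4 : (L + 1) * δ' ^ n < Real.exp (-(r * l i)) ^ n := by
    rw [div_pow, ← mul_div_assoc, div_lt_one (pow_pos (Real.exp_pos _) n)] at h3
    exact h3
  rw [← Real.rpow_le_rpow_iff (Finset.prod_nonneg fun k _ => hnn k) (Real.exp_pos _).le (hl0 i),
    ← Real.exp_mul]
  refine h2.le.trans ((mul_le_mul_of_nonneg_left h1 hL1).trans (h4.le.trans_eq ?_))
  rw [← Real.exp_nat_mul]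
  congr 1
  ring

/-- If the alternative density vanishes with positive probability at the limit of the parameters,
then it vanishes at some sample. -/
theorem ae_exists_density_eq_zero (h : SequentialSampling P ℱ κ q c)
    (ha : IsContinuousDensityFamily μ a) (hb : IsContinuousDensityFamily μ b)
    (hκ : ∀ x, κ x = densityLaw μ (a x)) :
    ∀ᵐ ω ∂P, ∀ x, Tendsto (fun k => q k ω) atTop (𝓝 x) →
      ¬ densityLaw μ (a x) ≪ densityLaw μ (b x) →
      ContinuousAt (fun x' => densityLaw μ (a x') {y | b x' y = 0}) x →
      ∃ k, b (q k ω) (c k ω) = 0 := by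
  set S : Set (X × Y) := {z | b z.1 z.2 = 0} with hS
  have hSm : MeasurableSet S := hb.measurable_uncurry (measurableSet_singleton 0)
  have hSx : ∀ x, MeasurableSet {y | b x y = 0} := fun x =>
    (hb.isProbDensity x).measurable (measurableSet_singleton 0)
  -- A factor is `exp (-1)` at a sample with `b = 0` and `1` otherwise, with conditional mean `1 - η
  -- * p`. If no sample hits the zero set, the normalized product is the reciprocal of `∏ (1 - η * p
  -- (q k ω))`, which diverges because `p (q k ω)` tends to `p x > 0`.
  filter_upwards [h.ae_tendsto_prod_exp_div
    (f := fun _ x y => S.indicator (fun _ => (-1 : ℝ)) (x, y))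
    (fun _ => (measurable_const.indicator hSm : Measurable (S.indicator fun _ => (-1 : ℝ))))
    (fun _ x y => by
      by_cases hz : (x, y) ∈ S <;> simp [hz])] with ω ⟨L, hL⟩ x hx hac hcont
  by_contra! hne
  have := fun x => (ha.isProbDensity x).isProbabilityMeasure
  set p : X → ℝ := fun x => (densityLaw μ (a x)).real {y | b x y = 0} with hp
  have hcp : Tendsto (fun k => p (q k ω)) atTop (𝓝 (p x)) :=
    ((ENNReal.tendsto_toReal (measure_ne_top _ _)).comp hcont.tendsto).comp hx
  have hp0 : 0 < p x := by
    refine measureReal_nonneg.lt_of_ne' fun h0 => hac ?_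
    rw [measureReal_eq_zero_iff] at h0
    rw [(ha.isProbDensity x).absolutelyContinuous_iff (hb.isProbDensity x)]
    filter_upwards [(ha.isProbDensity x).ae_law_iff.1 (measure_eq_zero_iff_ae_notMem.1 h0)]
      with y hy hb0
    by_contra hay
    exact hy hay hb0
  set η : ℝ := 1 - Real.exp (-1) with hη
  have hη0 : 0 < η := by
    have : Real.exp (-1) < 1 := Real.exp_lt_one_iff.2 (by norm_num)
    linarith
  have hη1 : η < 1 := by linarith [Real.exp_pos (-1)]
  have hint : ∀ x, ∫ y, Real.exp (S.indicator (fun _ => (-1 : ℝ)) (x, y)) ∂κ x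
      = 1 - η * p x := by
    intro x
    have e : (fun y => Real.exp (S.indicator (fun _ => (-1 : ℝ)) (x, y)))
        = fun y => 1 - η * ({y | b x y = 0}.indicator (fun _ => (1 : ℝ)) y) := by
      funext y
      by_cases hz : b x y = 0 <;> simp [hS, hz, hη]
    rw [e, hκ, integral_sub (integrable_const _)
      (((integrable_const _).indicator (hSx x)).const_mul _), integral_const_mul,
      integral_indicator_const _ (hSx x)]
    simp [hp]
  set v : ℕ → ℝ := fun k => 1 - η * p (q k ω) with hv
  have hp1 : ∀ x, p x ≤ 1 := fun x => measureReal_le_one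
  have hv0 : ∀ k, 0 < v k := by
    intro k
    have := hp1 (q k ω)
    have h0 : 0 ≤ p (q k ω) := measureReal_nonneg
    simp only [hv]
    nlinarith
  have hδ0 : 0 < 1 - η * (p x / 2) := by nlinarith [hp1 x]
  have hvδ : ∀ᶠ k in atTop, v k ≤ 1 - η * (p x / 2) := by
    filter_upwards [hcp.eventually (lt_mem_nhds (half_lt_self hp0))] with k hk
    simp only [hv]
    nlinarith
  obtain ⟨δ', hδ', hδ1⟩ := exists_between (show 1 - η * (p x / 2) < 1 by nlinarith)
  have hpow : Tendsto (fun n : ℕ => (L + 1) * δ' ^ n) atTop (𝓝 0) := by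
    have := (tendsto_pow_atTop_nhds_zero_of_lt_one (hδ0.trans hδ').le hδ1).const_mul (L + 1)
    rwa [mul_zero] at this
  obtain ⟨n, h1, h2, h3⟩ := ((eventually_prod_range_le_pow hv0 hδ0 hvδ hδ').and
    ((hL.eventually (gt_mem_nhds (lt_add_one L))).and
      (hpow.eventually (gt_mem_nhds one_pos)))).exists
  have hvp : 0 < ∏ k ∈ Finset.range n, v k := Finset.prod_pos fun k _ => hv0 k
  have hz : ∀ k, S.indicator (fun _ => (-1 : ℝ)) (q k ω, c k ω) = 0 := fun k =>
    Set.indicator_of_notMem (show (q k ω, c k ω) ∉ S from hne k) _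
  simp only [hint, hz, Real.exp_zero] at h2
  rw [Finset.prod_div_distrib, Finset.prod_const_one, div_lt_iff₀ hvp] at h2
  have hL1 : 0 < L + 1 := by
    by_contra hcon
    nlinarith [not_lt.1 hcon]
  nlinarith

end SequentialSampling

end LikelihoodRatio

/-! ### The exact exponential rate under a moment bound -/

section LikelihoodRatio

variable {Ω X Y : Type*} [TopologicalSpace X] [TopologicalSpace.MetrizableSpace X]
  [SecondCountableTopology X] [MeasurableSpace X] [BorelSpace X] [MeasurableSpace Y]
  {μ : Measure Y} {a b : X → Y → ℝ}
  {m0 : MeasurableSpace Ω} {P : Measure Ω} [IsFiniteMeasure P] {ℱ : Filtration ℕ m0}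
  {κ : Kernel X Y} [IsMarkovKernel κ] {q : ℕ → Ω → X} {c : ℕ → Ω → Y}

namespace SequentialSampling

/-- Under a locally bounded moment of order greater than one, the log-likelihood ratio grows at
most at the rate given by the divergence at the limit of the parameters. -/
theorem ae_eventually_sum_log_div_le (h : SequentialSampling P ℱ κ q c)
    (ha : IsContinuousDensityFamily μ a) (hb : IsContinuousDensityFamily μ b)
    (hκ : ∀ x, κ x = densityLaw μ (a x)) :
    ∀ᵐ ω ∂P, ∀ x, Tendsto (fun k => q k ω) atTop (𝓝 x) → ∀ p : ℝ, 1 < p → ∀ C : ℝ≥0,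
      (∀ᶠ x' in 𝓝 x, ∫⁻ y, ENNReal.ofReal (|Real.log (a x' y / b x' y)| ^ p)
        ∂densityLaw μ (a x') ≤ C) →
      densityLaw μ (a x) ≪ densityLaw μ (b x) →
      ∀ ε : ℝ, 0 < ε → ∀ᶠ n : ℕ in atTop,
        ∑ k ∈ Finset.range n, Real.log (a (q k ω) (c k ω) / b (q k ω) (c k ω))
          ≤ n * (∫ y, Real.log (a x y / b x y) ∂densityLaw μ (a x) + ε) := by
  set Z : X → Y → ℝ := fun x y => Real.log (a x y / b x y) with hZ
  have hZm : Measurable (Function.uncurry Z) :=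
    (ha.measurable_uncurry.div hb.measurable_uncurry).log
  have hZx : ∀ x, Measurable (Z x) := fun x => hZm.comp measurable_prodMk_left
  -- `f k` is the truncation of `Z` at level `k + 1`, rescaled to `[-1, 1]`; `g k` indicates that
  -- this truncation takes effect.
  set f : ℕ → X → Y → ℝ := fun k x y => max (-1) (min 1 (Z x y / (k + 1))) with hf
  set g : ℕ → X → Y → ℝ := fun k x y => if (k : ℝ) + 1 < |Z x y| then 1 else 0 with hg
  have hfm : ∀ k, Measurable (Function.uncurry (f k)) := fun k =>
    measurable_const.max (measurable_const.min (hZm.div_const _))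
  have hgm : ∀ k, Measurable (Function.uncurry (g k)) := fun k =>
    Measurable.ite (measurableSet_lt measurable_const hZm.abs) measurable_const measurable_const
  have hf1 : ∀ k x y, |f k x y| ≤ 1 := fun k x y =>
    abs_le.2 ⟨le_max_left _ _, max_le (by norm_num) (min_le_left _ _)⟩
  have hg1 : ∀ k x y, |g k x y| ≤ 1 := fun k x y => by
    simp only [hg]
    split_ifs <;> simp
  have hM : ∀ k : ℕ, (0 : ℝ) < k + 1 := fun k => by positivity
  have hfZ : ∀ k x y, |f k x y| ≤ |Z x y| / (k + 1) := fun k x y => by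
    have h0 : 0 ≤ |Z x y| / (k + 1) := div_nonneg (abs_nonneg _) (hM k).le
    have e : |Z x y / (k + 1)| = |Z x y| / (k + 1) := by rw [abs_div, abs_of_pos (hM k)]
    obtain ⟨h1, h2⟩ := abs_le.1 e.le
    simp only [hf]
    refine abs_le.2 ⟨?_, max_le (by linarith) ((min_le_right _ _).trans h2)⟩
    exact le_max_iff.2 (Or.inr (le_min (by linarith) h1))
  have hgZ : ∀ k x y, |g k x y| ≤ |Z x y| / (k + 1) := fun k x y => by
    simp only [hg]
    split_ifs with hz
    · rw [abs_one, one_le_div (hM k)]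
      exact hz.le
    · rw [abs_zero]
      exact div_nonneg (abs_nonneg _) (hM k).le
  filter_upwards [h.ae_tendsto_sum_sub_integral hfm hf1, h.ae_tendsto_sum_sub_integral hgm hg1]
    with ω hωf hωg x hx p hp C hC hab ε hε
  have := fun x => (ha.isProbDensity x).isProbabilityMeasure
  have hmom : ∀ x', ∫⁻ y, ENNReal.ofReal (|Z x' y| ^ p) ∂densityLaw μ (a x') ≤ C →
      Integrable (fun y => |Z x' y| ^ p) (densityLaw μ (a x')) ∧
      ∫ y, |Z x' y| ^ p ∂densityLaw μ (a x') ≤ C := by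
    intro x' hx'
    have h0 : ∀ y, 0 ≤ |Z x' y| ^ p := fun y => Real.rpow_nonneg (abs_nonneg _) _
    have hm : Measurable fun y => |Z x' y| ^ p := (hZx x').abs.pow_const p
    refine ⟨⟨hm.aestronglyMeasurable, ?_⟩, ?_⟩
    · rw [hasFiniteIntegral_iff_ofReal (ae_of_all _ h0)]
      exact hx'.trans_lt ENNReal.coe_lt_top
    · rw [integral_eq_lintegral_of_nonneg_ae (ae_of_all _ h0) hm.aestronglyMeasurable]
      exact ENNReal.toReal_le_coe_of_le_coe hx'
  have hCq := hx.eventually hC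
  have hsum : ∀ u : ℕ → X → Y → ℝ, (∀ k, Measurable (Function.uncurry (u k))) →
      (∀ k x y, |u k x y| ≤ 1) → (∀ k x y, |u k x y| ≤ |Z x y| / (k + 1)) →
      Summable fun k => ∫ y, u k (q k ω) y ^ 2 ∂κ (q k ω) := by
    intro u hum hu1 huZ
    have hs : Summable fun k : ℕ => (1 + C : ℝ) * ((k : ℝ) + 1) ^ (-min p 2) := by
      have h2 : 1 < min p 2 := lt_min hp (by norm_num)
      have := (summable_nat_add_iff 1).2 (Real.summable_nat_rpow.2 (neg_lt_neg h2))
      simp only [Nat.cast_add, Nat.cast_one] at this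
      exact this.mul_left _
    -- The moment bound holds only near the limit, hence only for late `k`, which suffices.
    refine Summable.of_norm_bounded_eventually_nat hs ?_
    filter_upwards [hCq] with k hk
    obtain ⟨hi, hle⟩ := hmom _ hk
    rw [Real.norm_of_nonneg (integral_nonneg fun y => sq_nonneg _), hκ]
    have hux : Measurable fun y => u k (q k ω) y := (hum k).comp measurable_prodMk_left
    calc ∫ y, u k (q k ω) y ^ 2 ∂densityLaw μ (a (q k ω))
        ≤ ∫ y, (1 + |Z (q k ω) y| ^ p) * ((k : ℝ) + 1) ^ (-min p 2)
            ∂densityLaw μ (a (q k ω)) := by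
          refine integral_mono ?_ (((integrable_const 1).add hi).mul_const _) fun y =>
            sq_le_one_add_rpow_mul (hM k) hp (hu1 k _ y) (huZ k _ y)
          refine Integrable.of_bound (C := 1) (hux.pow_const 2).aestronglyMeasurable
            (ae_of_all _ fun y => ?_)
          rw [Real.norm_of_nonneg (sq_nonneg _), ← sq_abs]
          exact pow_le_one₀ (abs_nonneg _) (hu1 k _ y)
      _ ≤ _ := by
          rw [integral_mul_const, integral_add (integrable_const 1) hi]
          refine mul_le_mul_of_nonneg_right ?_ (Real.rpow_nonneg (hM k).le _)
          simpa using hle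
  obtain ⟨L, hL⟩ := hωf (hsum f hfm hf1 hfZ)
  have hgs := hsum g hgm hg1 hgZ
  obtain ⟨L', hL'⟩ := hωg hgs
  have hg2 : ∀ k x y, g k x y ^ 2 = g k x y := fun k x y => by
    simp only [hg]
    split_ifs <;> simp
  simp only [hg2] at hgs
  -- Borel-Cantelli: as `g ^ 2 = g`, the conditional means are summable too, so the sum of the
  -- indicators converges and truncation stops occurring.
  have hg0 : Tendsto (fun k => g k (q k ω) (c k ω)) atTop (𝓝 0) := by
    have h1 := hL'.add hgs.hasSum.tendsto_sum_nat
    simp only [← Finset.sum_add_distrib, sub_add_cancel] at h1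
    have h2 := ((tendsto_add_atTop_iff_nat 1).2 h1).sub h1
    simpa only [Finset.sum_range_succ, add_sub_cancel_left, sub_self] using h2
  have hsmall : ∀ᶠ k : ℕ in atTop, |Z (q k ω) (c k ω)| ≤ k + 1 := by
    filter_upwards [hg0.eventually (gt_mem_nhds one_pos)] with k hk
    by_contra hcon
    simp only [hg, if_pos (not_le.1 hcon), lt_irrefl] at hk
  have htrunc : ∀ (k : ℕ) x y, ((k : ℝ) + 1) * f k x y
      = max (-((k : ℝ) + 1)) (min ((k : ℝ) + 1) (Z x y)) := by
    intro k x y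
    simp only [hf]
    rw [mul_max_of_nonneg _ _ (hM k).le, mul_min_of_nonneg _ _ (hM k).le,
      mul_div_cancel₀ _ (hM k).ne']
    simp
  have hint : Integrable (Z x) (densityLaw μ (a x)) := by
    refine ((integrable_const 1).add (hmom x hC.self_of_nhds).1).mono'
      (hZx x).aestronglyMeasurable (ae_of_all _ fun y => ?_)
    rw [Real.norm_eq_abs, Pi.add_apply]
    rcases le_total |Z x y| 1 with h1 | h1
    · have := Real.rpow_nonneg (abs_nonneg (Z x y)) p
      linarith
    · have := Real.self_le_rpow_of_one_le h1 hp.le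
      linarith
  have hNt : Tendsto (fun k : ℕ => (k : ℝ) + 1) atTop atTop :=
    tendsto_atTop_add_const_right _ _ tendsto_natCast_atTop_atTop
  have hmean := (ha.isProbDensity x).eventually_integral_truncated_log_le (hb.isProbDensity x)
    (fun k => ha.isProbDensity (q k ω)) (fun k => hb.isProbDensity (q k ω))
    (fun y => ((ha.continuous y).tendsto x).comp hx)
    (fun y => ((hb.continuous y).tendsto x).comp hx) hab hint hp hCq hNt
    (fun k => (hM k).le) (show 0 < ε / 4 by positivity)
  set D := ∫ y, Z x y ∂densityLaw μ (a x) with hD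
  -- Once truncation has stopped, `w k` is the conditional mean of the truncated ratio; Kronecker's
  -- lemma averages out the rest.
  set w : ℕ → ℝ := fun k => Z (q k ω) (c k ω) - ((k : ℝ) + 1) *
    (f k (q k ω) (c k ω) - ∫ y, f k (q k ω) y ∂κ (q k ω)) with hw
  have hwle : ∀ᶠ k in atTop, w k ≤ D + ε / 4 := by
    filter_upwards [hmean, hsmall] with k h1 h2
    obtain ⟨h3, h4⟩ := abs_le.1 h2
    have e1 : ((k : ℝ) + 1) * f k (q k ω) (c k ω) = Z (q k ω) (c k ω) := by
      rw [htrunc, min_eq_right h4, max_eq_right h3]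
    have e2 : ((k : ℝ) + 1) * ∫ y, f k (q k ω) y ∂κ (q k ω)
        = ∫ y, max (-((k : ℝ) + 1)) (min ((k : ℝ) + 1) (Z (q k ω) y))
          ∂densityLaw μ (a (q k ω)) := by
      rw [← integral_const_mul, hκ]
      simp only [htrunc]
    simp only [hw]
    rw [mul_sub, e1, e2]
    linarith
  filter_upwards [eventually_sum_range_le hwle (show D + ε / 4 < D + ε / 2 by linarith),
    (tendsto_inv_mul_sum_succ_mul hL).eventually (gt_mem_nhds (half_pos hε)),
    eventually_gt_atTop 0] with n h1 h2 hn
  have hn0 : (0 : ℝ) < n := by exact_mod_cast hn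
  rw [inv_mul_lt_iff₀ hn0] at h2
  simp only [hw, Finset.sum_sub_distrib] at h1
  simp only [Finset.sum_sub_distrib, mul_sub] at h1 h2
  linarith

/-- Under a locally bounded moment of order greater than one, the exponential rate of the
likelihood ratio is the divergence at the limit of the parameters. -/
theorem ae_tendsto_log_prod_div [SigmaFinite μ] (h : SequentialSampling P ℱ κ q c)
    (ha : IsContinuousDensityFamily μ a) (hb : IsContinuousDensityFamily μ b)
    (hκ : ∀ x, κ x = densityLaw μ (a x)) :
    ∀ᵐ ω ∂P, ∀ x, Tendsto (fun k => q k ω) atTop (𝓝 x) →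
      0 < klDiv (densityLaw μ (a x)) (densityLaw μ (b x)) → ∀ p : ℝ, 1 < p → ∀ C : ℝ≥0,
      (∀ᶠ x' in 𝓝 x, densityLaw μ (a x') ≪ densityLaw μ (b x') ∧
        ∫⁻ y, ENNReal.ofReal (|Real.log (a x' y / b x' y)| ^ p) ∂densityLaw μ (a x') ≤ C) →
      (∀ n, 0 < ∏ k ∈ Finset.range n, b (q k ω) (c k ω) / a (q k ω) (c k ω)) →
      Tendsto (fun n : ℕ => (n : ℝ)⁻¹ *
        Real.log (∏ k ∈ Finset.range n, b (q k ω) (c k ω) / a (q k ω) (c k ω))) atTop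
        (𝓝 (-(klDiv (densityLaw μ (a x)) (densityLaw μ (b x))).toReal)) := by
  filter_upwards [h.ae_eventually_prod_div_le ha hb hκ, h.ae_eventually_sum_log_div_le ha hb hκ]
    with ω h1 h2 x hx hkl p hp C hC hpos
  have hab := hC.self_of_nhds.1
  set D := klDiv (densityLaw μ (a x)) (densityLaw μ (b x)) with hD
  have hne : ∀ k, b (q k ω) (c k ω) / a (q k ω) (c k ω) ≠ 0 := fun k => by
    have := (hpos (k + 1)).ne'
    rw [Finset.prod_range_succ] at this
    exact (mul_ne_zero_iff.1 this).2
  have hlog : ∀ n : ℕ, Real.log (∏ k ∈ Finset.range n, b (q k ω) (c k ω) / a (q k ω) (c k ω))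
      = -∑ k ∈ Finset.range n, Real.log (a (q k ω) (c k ω) / b (q k ω) (c k ω)) := by
    intro n
    rw [Real.log_prod fun k _ => hne k, ← Finset.sum_neg_distrib]
    refine Finset.sum_congr rfl fun k _ => ?_
    rw [← Real.log_inv, inv_div]
  have hDint := (ha.isProbDensity x).toReal_klDiv_law (hb.isProbDensity x) hab
  rw [← hD] at hDint
  refine tendsto_order.2 ⟨fun r hr => ?_, fun r hr => ?_⟩
  · have hε : 0 < (-D.toReal - r) / 2 := by linarith
    filter_upwards [h2 x hx p hp C (hC.mono fun _ h => h.2) hab _ hε, eventually_gt_atTop 0]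
      with n hn hn0
    have hn0' : (0 : ℝ) < n := by exact_mod_cast hn0
    rw [lt_inv_mul_iff₀ hn0', hlog]
    rw [← hDint] at hn
    nlinarith
  · obtain ⟨r', hr', hr'D⟩ : ∃ r', -r' < r ∧ ENNReal.ofReal r' < D := by
      -- For `D = ∞` every real rate is available. Otherwise the rate is taken positive, since
      -- `ENNReal.ofReal` sends negative numbers to zero.
      rcases eq_or_ne D ∞ with htop | htop
      · exact ⟨1 - r, by linarith, htop ▸ ENNReal.ofReal_lt_top⟩
      · have hD0 : 0 < D.toReal := ENNReal.toReal_pos hkl.ne' htop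
        obtain ⟨s, hs1, hs2⟩ := exists_between (max_lt hD0 (by linarith : -r < D.toReal))
        refine ⟨s, by linarith [le_max_right 0 (-r)], ?_⟩
        rw [ENNReal.ofReal_lt_iff_lt_toReal ((le_max_left _ _).trans hs1.le) htop]
        exact hs2
    filter_upwards [h1 x hx r' hr'D, eventually_gt_atTop 0] with n hn hn0
    have hn0' : (0 : ℝ) < n := by exact_mod_cast hn0
    rw [inv_mul_lt_iff₀ hn0']
    have := (Real.log_le_iff_le_exp (hpos n)).2 hn
    nlinarith

end SequentialSampling

end LikelihoodRatio

/-! ### Convex steps and room between rates -/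

/-- A sequence that moves by convex steps towards a convergent sequence converges to its limit,
if the products of the complementary stepsizes vanish. -/
theorem tendsto_of_convex_step {E : Type*} [NormedAddCommGroup E] [NormedSpace ℝ E]
    {α : ℕ → ℝ} (hα : ∀ k, α k ∈ Set.Icc (0 : ℝ) 1)
    (hprod : ∀ m : ℕ, Tendsto (fun n => ∏ k ∈ Finset.Ico m n, (1 - α k)) atTop (𝓝 0))
    {x y : ℕ → E} {z : E} (hx : ∀ k, x (k + 1) = (1 - α k) • x k + α k • y k)
    (hy : Tendsto y atTop (𝓝 z)) : Tendsto x atTop (𝓝 z) := by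
  rw [Metric.tendsto_atTop] at hy ⊢
  intro ε hε
  obtain ⟨m, hm⟩ := hy (ε / 2) (half_pos hε)
  -- After time `m` the targets are within `ε / 2` of `z`, so only the initial error exceeds that,
  -- and it shrinks with the product.
  have key : ∀ n ≥ m, ‖x n - z‖ ≤ ε / 2 + (∏ k ∈ Finset.Ico m n, (1 - α k)) * ‖x m - z‖ := by
    intro n hn
    induction n, hn using Nat.le_induction with
    | base =>
      simp only [Finset.Ico_self, Finset.prod_empty, one_mul]
      linarith
    | succ n hn ih =>
      obtain ⟨h0, h1⟩ := hα n
      have e : x (n + 1) - z = (1 - α n) • (x n - z) + α n • (y n - z) := by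
        rw [hx]
        module
      have hyn := (hm n hn).le
      rw [dist_eq_norm] at hyn
      rw [Finset.prod_Ico_succ_top hn, e]
      calc _ ≤ (1 - α n) * ‖x n - z‖ + α n * ‖y n - z‖ := by
            refine (norm_add_le _ _).trans_eq ?_
            rw [norm_smul, norm_smul, Real.norm_of_nonneg h0, Real.norm_of_nonneg (by linarith)]
        _ ≤ (1 - α n) * (ε / 2 + (∏ k ∈ Finset.Ico m n, (1 - α k)) * ‖x m - z‖)
              + α n * (ε / 2) :=
            add_le_add (mul_le_mul_of_nonneg_left ih (by linarith))
              (mul_le_mul_of_nonneg_left hyn h0)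
        _ = _ := by ring
  have h0 := (hprod m).mul_const ‖x m - z‖
  rw [zero_mul] at h0
  obtain ⟨N, hN⟩ := eventually_atTop.1 (h0.eventually (gt_mem_nhds (half_pos hε)))
  refine ⟨max m N, fun n hn => ?_⟩
  rw [dist_eq_norm]
  have h1 := key n ((le_max_left _ _).trans hn)
  have h2 := hN n ((le_max_right _ _).trans hn)
  linarith

/-- The larger rate leaves room to absorb constant factors. -/
theorem exists_pos_lt_of_ofReal_lt {r : ℝ} {D : ℝ≥0∞} (h : ENNReal.ofReal r < D) :
    ∃ r', r < r' ∧ 0 < r' ∧ ENNReal.ofReal r' < D := by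
  obtain ⟨x, hx, hxD⟩ := ENNReal.lt_iff_exists_nnreal_btwn.1 h
  have hx' : r.toNNReal < x := ENNReal.coe_lt_coe.1 hx
  refine ⟨x, ?_, ?_, ?_⟩
  · exact (Real.le_coe_toNNReal r).trans_lt (by exact_mod_cast hx')
  · exact_mod_cast bot_le.trans_lt hx'
  · rwa [ENNReal.ofReal_coe_nnreal]

/-! ### The learning dynamics -/

namespace ParametricGame

variable {I S : Type*} [Fintype I] {d : I → ℕ}

theorem isContinuousDensityFamily (G : ParametricGame I S d) (s : S) :
    IsContinuousDensityFamily (volume : Measure (I → ℝ))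
      (fun (x : G.profiles) y => G.φ s x y) where
  isProbDensity x := ⟨G.φ_measurable s x x.2, G.φ_nonneg s x x.2, G.φ_integral s x x.2⟩
  continuous y := (G.φ_continuous s y).comp_continuous continuous_subtype_val fun x => x.2

/-- The payoff distribution as a Markov kernel on the feasible profiles. -/
noncomputable def payoffKernel (G : ParametricGame I S d) (s : S) :
    Kernel G.profiles (I → ℝ) :=
  (Kernel.const G.profiles (volume : Measure (I → ℝ))).withDensity
    fun x y => ENNReal.ofReal (G.φ s x y)

theorem payoffKernel_apply (G : ParametricGame I S d) (s : S) (x : G.profiles) :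
    G.payoffKernel s x = densityLaw volume (G.φ s x) := by
  rw [payoffKernel, Kernel.withDensity_apply _
    (G.isContinuousDensityFamily s).measurable_uncurry.ennreal_ofReal, Kernel.const_apply,
    densityLaw]

instance (G : ParametricGame I S d) (s : S) : IsMarkovKernel (G.payoffKernel s) :=
  ⟨fun x => by
    rw [payoffKernel_apply]
    exact ((G.isContinuousDensityFamily s).isProbDensity x).isProbabilityMeasure⟩

/-- The filtration generated by the payoffs. -/
def historyFiltration {Ω : Type*} [m0 : MeasurableSpace Ω] {c : ℕ → Ω → I → ℝ}
    (hc : ∀ k, Measurable (c k)) : Filtration ℕ m0 where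
  seq k := history c k
  mono' _ _ hkn := iSup_le fun j => le_iSup_of_le (Fin.castLE hkn j) le_rfl
  le' _ := iSup_le fun j => (hc j).comap_le

theorem measurable_payoff_history {J Ω : Type*} (c : ℕ → Ω → J → ℝ) (k : ℕ) :
    Measurable[history c (k + 1)] (c k) := by
  have h : MeasurableSpace.comap (c k) inferInstance ≤ history c (k + 1) :=
    le_iSup (fun j : Fin (k + 1) => MeasurableSpace.comap (c j) inferInstance) (Fin.last k)
  exact fun B hB => h _ ⟨B, hB, rfl⟩

variable [Fintype S]

/-- The beliefs that give positive weight to `sStar`. -/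
abbrev PosBelief (sStar : S) : Type _ := {θ : S → ℝ // θ ∈ stdSimplex ℝ S ∧ 0 < θ sStar}

theorem sum_mul_density_pos (G : ParametricGame I S d) {sStar : S} {q : Profile d}
    (hq : q ∈ G.profiles) {θ : S → ℝ} (hθ : θ ∈ stdSimplex ℝ S) (hθs : 0 < θ sStar)
    {y : I → ℝ} (hy : 0 < G.φ sStar q y) : 0 < ∑ s, θ s * G.φ s q y :=
  Finset.sum_pos' (fun s _ => mul_nonneg (hθ.1 s) (G.φ_nonneg s q hq y))
    ⟨sStar, Finset.mem_univ _, mul_pos hθs hy⟩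

theorem bayesUpdate_mem (G : ParametricGame I S d) {sStar : S} {q : Profile d}
    (hq : q ∈ G.profiles) {θ : S → ℝ} (hθ : θ ∈ stdSimplex ℝ S) (hθs : 0 < θ sStar)
    {y : I → ℝ} (hy : 0 < G.φ sStar q y) :
    G.bayesUpdate θ q y ∈ stdSimplex ℝ S ∧ 0 < G.bayesUpdate θ q y sStar := by
  have hpos := G.sum_mul_density_pos hq hθ hθs hy
  refine ⟨⟨fun s => div_nonneg (mul_nonneg (hθ.1 s) (G.φ_nonneg s q hq y)) hpos.le, ?_⟩,
    div_pos (mul_pos hθs hy) hpos⟩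
  simp only [bayesUpdate]
  rw [← Finset.sum_div, div_self hpos.ne']

open Classical in
/-- Bayes update that leaves the belief unchanged at payoffs of density zero under `sStar`. -/
noncomputable def safeUpdate (G : ParametricGame I S d) {sStar : S} (θ : PosBelief sStar)
    (x : G.profiles) (y : I → ℝ) : PosBelief sStar :=
  ⟨if 0 < G.φ sStar x y then G.bayesUpdate θ x y else θ, by
    split_ifs with h
    · exact G.bayesUpdate_mem x.2 θ.2.1 θ.2.2 h
    · exact θ.2⟩

theorem measurable_safeUpdate (G : ParametricGame I S d) (sStar : S) :
    Measurable fun z : (PosBelief sStar × G.profiles) × (I → ℝ) =>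
      G.safeUpdate z.1.1 z.1.2 z.2 := by
  have hφ : ∀ s, Measurable fun z : (PosBelief sStar × G.profiles) × (I → ℝ) =>
      G.φ s z.1.2 z.2 := fun s =>
    (G.isContinuousDensityFamily s).measurable_uncurry.comp
      ((measurable_snd.comp measurable_fst).prodMk measurable_snd)
  have hθ : Measurable fun z : (PosBelief sStar × G.profiles) × (I → ℝ) => (z.1.1 : S → ℝ) :=
    measurable_subtype_coe.comp (measurable_fst.comp measurable_fst)
  have hθs : ∀ s, Measurable fun z : (PosBelief sStar × G.profiles) × (I → ℝ) =>
      (z.1.1 : S → ℝ) s := fun s => (measurable_pi_apply s).comp hθ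
  refine Measurable.subtype_mk ?_
  refine Measurable.ite (measurableSet_lt measurable_const (hφ sStar)) ?_ hθ
  refine measurable_pi_lambda _ fun s => ?_
  exact ((hθs s).mul (hφ s)).div
    (Finset.measurable_fun_sum _ fun s' _ => (hθs s').mul (hφ s'))

/-- The profile obtained by moving from `x` towards `g θ`. -/
noncomputable def safeMove (G : ParametricGame I S d) {sStar : S} {g : (S → ℝ) → Profile d}
    (hg : ∀ θ ∈ stdSimplex ℝ S, g θ ∈ G.profiles) {α : I → ℝ}
    (hα : ∀ i, α i ∈ Set.Icc (0 : ℝ) 1) (θ : PosBelief sStar) (x : G.profiles) : G.profiles :=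
  ⟨fun i => (1 - α i) • (x : Profile d) i + α i • g θ i, fun i hi =>
    G.convex_Q i (x.2 i hi) (hg θ θ.2.1 i hi) (by linarith [(hα i).2]) (hα i).1 (by ring)⟩

theorem measurable_safeMove (G : ParametricGame I S d) {sStar : S} {g : (S → ℝ) → Profile d}
    (hg : ∀ θ ∈ stdSimplex ℝ S, g θ ∈ G.profiles) (hg_cont : ContinuousOn g (stdSimplex ℝ S))
    {α : I → ℝ} (hα : ∀ i, α i ∈ Set.Icc (0 : ℝ) 1) :
    Measurable fun z : PosBelief sStar × G.profiles => G.safeMove hg hα z.1 z.2 := by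
  have hgm : Continuous fun θ : PosBelief sStar => g θ :=
    hg_cont.comp_continuous continuous_subtype_val fun θ => θ.2.1
  refine (Continuous.subtype_mk ?_ _).measurable
  refine continuous_pi fun i => ?_
  have h1 : Continuous fun z : PosBelief sStar × G.profiles => (z.2 : Profile d) i :=
    (continuous_apply i).comp (continuous_subtype_val.comp continuous_snd)
  have h2 : Continuous fun z : PosBelief sStar × G.profiles => g z.1 i :=
    (continuous_apply i).comp (hgm.comp continuous_fst)
  exact (h1.const_smul (1 - α i)).add (h2.const_smul (α i))

/-- The learning dynamics with `safeUpdate`, which stays in the state space everywhere. -/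
noncomputable def safeState (G : ParametricGame I S d) {sStar : S} {g : (S → ℝ) → Profile d}
    (hg : ∀ θ ∈ stdSimplex ℝ S, g θ ∈ G.profiles) {a : ℕ → I → ℝ}
    (ha : ∀ k i, a k i ∈ Set.Icc (0 : ℝ) 1) (θ₁ : PosBelief sStar) (q₁ : G.profiles)
    (c : ℕ → I → ℝ) : ℕ → PosBelief sStar × G.profiles
  | 0 => (θ₁, q₁)
  | k + 1 =>
    let z := safeState G hg ha θ₁ q₁ c k
    let θ' := G.safeUpdate z.1 z.2 (c k)
    (θ', G.safeMove hg (ha k) θ' z.2)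

section Dynamics

variable (G : ParametricGame I S d) {sStar : S} {g : (S → ℝ) → Profile d}
  (hg : ∀ θ ∈ stdSimplex ℝ S, g θ ∈ G.profiles) {a : ℕ → I → ℝ}
  (ha : ∀ k i, a k i ∈ Set.Icc (0 : ℝ) 1) (θ₁ : PosBelief sStar) (q₁ : G.profiles)

/-- `g` is controlled only on the simplex and the densities only on feasible profiles, so the
original recursion need not be measurable off them; the modified one never leaves them. -/
theorem measurable_safeState (hg_cont : ContinuousOn g (stdSimplex ℝ S)) {Ω : Type*}
    [MeasurableSpace Ω] {c : ℕ → Ω → I → ℝ} (hc : ∀ k, Measurable (c k)) (k : ℕ) :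
    Measurable[historyFiltration hc k]
      fun ω => G.safeState hg ha θ₁ q₁ (fun j => c j ω) k := by
  induction k with
  | zero => exact measurable_const
  | succ k ih =>
    have h1 := ih.mono ((historyFiltration hc).mono k.le_succ) le_rfl
    have h2 : Measurable[historyFiltration hc (k + 1)] (c k) := measurable_payoff_history c k
    have h3 := (G.measurable_safeUpdate sStar).comp (h1.prodMk h2)
    exact h3.prodMk ((G.measurable_safeMove hg hg_cont (ha k)).comp (h3.prodMk h1.snd))

theorem state_succ_eq_safeState {c : ℕ → I → ℝ} {k : ℕ}
    (h : G.state g a θ₁ q₁ c k =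
      Prod.map Subtype.val Subtype.val (G.safeState hg ha θ₁ q₁ c k))
    (hpos : 0 < G.φ sStar (G.safeState hg ha θ₁ q₁ c k).2 (c k)) :
    G.state g a θ₁ q₁ c (k + 1) =
      Prod.map Subtype.val Subtype.val (G.safeState hg ha θ₁ q₁ c (k + 1)) := by
  have e : ((G.safeUpdate (G.safeState hg ha θ₁ q₁ c k).1 (G.safeState hg ha θ₁ q₁ c k).2
      (c k) : PosBelief sStar) : S → ℝ) = G.bayesUpdate (G.safeState hg ha θ₁ q₁ c k).1
      (G.safeState hg ha θ₁ q₁ c k).2 (c k) := if_pos hpos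
  simp only [state, safeState, safeMove, h, e, Prod.map]

theorem condLaw_safeState {Ω : Type*} [MeasurableSpace Ω] {P : Measure Ω}
    {c : ℕ → Ω → I → ℝ} (hc : G.IsPayoffSequence sStar g a θ₁ q₁ P c) {k : ℕ}
    (h : ∀ᵐ ω ∂P, G.state g a θ₁ q₁ (fun j => c j ω) k =
      
      Prod.map Subtype.val Subtype.val (G.safeState hg ha θ₁ q₁ (fun j => c j ω) k)) (B : Set (I → ℝ))
    (hB : MeasurableSet B) :
    P[(c k ⁻¹' B).indicator (fun _ => (1 : ℝ)) | historyFiltration hc.measurable k] =ᵐ[P]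
      fun ω => (G.payoffKernel sStar (G.safeState hg ha θ₁ q₁ (fun j => c j ω) k).2).real B := by
  filter_upwards [hc.condLaw k B hB, h] with ω h1 h2
  refine h1.trans ?_
  rw [strategy, h2, payoffKernel_apply]
  rfl

/-- Agreement at time `k` identifies the conditional law of `c k`, so its true density is almost
surely positive, and then both updates agree at time `k + 1`. -/
theorem ae_state_eq_safeState (hg_cont : ContinuousOn g (stdSimplex ℝ S)) {Ω : Type*}
    [MeasurableSpace Ω] {P : Measure Ω} [IsProbabilityMeasure P] {c : ℕ → Ω → I → ℝ}
    (hc : G.IsPayoffSequence sStar g a θ₁ q₁ P c) (k : ℕ) :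
    ∀ᵐ ω ∂P, G.state g a θ₁ q₁ (fun j => c j ω) k =
      
      Prod.map Subtype.val Subtype.val (G.safeState hg ha θ₁ q₁ (fun j => c j ω) k) := by
  induction k with
  | zero => exact ae_of_all _ fun ω => rfl
  | succ k ih =>
    have hpos := ae_mem_of_condExp_indicator ((historyFiltration hc.measurable).le k)
      (κ := G.payoffKernel sStar)
      (G.measurable_safeState hg ha θ₁ q₁ hg_cont hc.measurable k).snd (hc.measurable k)
      (G.condLaw_safeState hg ha θ₁ q₁ hc ih)
      (s := {z : G.profiles × (I → ℝ) | 0 < G.φ sStar z.1 z.2})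
      (measurableSet_lt measurable_const
        (G.isContinuousDensityFamily sStar).measurable_uncurry) fun x => by
        rw [payoffKernel_apply]
        exact ((G.isContinuousDensityFamily sStar).isProbDensity x).ae_law_pos
    filter_upwards [ih, hpos] with ω h1 h2
    exact G.state_succ_eq_safeState hg ha θ₁ q₁ h1 h2

theorem sequentialSampling_safeState (hg_cont : ContinuousOn g (stdSimplex ℝ S)) {Ω : Type*}
    [MeasurableSpace Ω] {P : Measure Ω} [IsProbabilityMeasure P] {c : ℕ → Ω → I → ℝ}
    (hc : G.IsPayoffSequence sStar g a θ₁ q₁ P c) :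
    SequentialSampling P (historyFiltration hc.measurable) (G.payoffKernel sStar)
      (fun k ω => (G.safeState hg ha θ₁ q₁ (fun j => c j ω) k).2) c where
  measurable_param k := (G.measurable_safeState hg ha θ₁ q₁ hg_cont hc.measurable k).snd
  measurable_sample k := measurable_payoff_history c k
  condLaw k := G.condLaw_safeState hg ha θ₁ q₁ hc (G.ae_state_eq_safeState hg ha θ₁ q₁ hg_cont hc k)

end Dynamics

end ParametricGame

/-! ### Beliefs and strategies along a single path -/

namespace ParametricGame

variable {I S : Type*} [Fintype I] {d : I → ℕ} [Fintype S]

section BayesianBeliefs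

variable (G : ParametricGame I S d) {sStar : S} {θ : ℕ → S → ℝ} {q : ℕ → Profile d}
  {c : ℕ → I → ℝ} (hθ : ∀ k, θ k ∈ stdSimplex ℝ S) (hθs : ∀ k, 0 < θ k sStar)
  (hq : ∀ k, q k ∈ G.profiles) (hφ : ∀ k, 0 < G.φ sStar (q k) (c k))
  (hsucc : ∀ k, θ (k + 1) = G.bayesUpdate (θ k) (q k) (c k))

include hθ hθs hq hφ hsucc

/-- The normalizer of Bayes' rule cancels in the ratio of the beliefs in `s` and `sStar`. -/
theorem bayes_eq_mul_prod (s : S) (n : ℕ) :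
    θ n s = θ 0 s / θ 0 sStar *
      (∏ k ∈ Finset.range n, G.φ s (q k) (c k) / G.φ sStar (q k) (c k)) * θ n sStar := by
  induction n with
  | zero => simp [(hθs 0).ne']
  | succ n ih =>
    have hZ := G.sum_mul_density_pos (hq n) (hθ n) (hθs n) (hφ n)
    simp only [hsucc, bayesUpdate, Finset.prod_range_succ]
    rw [ih]
    have h1 := (hφ n).ne'
    have h2 := hZ.ne'
    field_simp

theorem exists_tendsto_bayes (hconv : ∀ s, ∃ L, Tendsto (fun n => ∏ k ∈ Finset.range n,
      G.φ s (q k) (c k) / G.φ sStar (q k) (c k)) atTop (𝓝 L)) :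
    ∃ θbar ∈ stdSimplex ℝ S, 0 < θbar sStar ∧ Tendsto θ atTop (𝓝 θbar) := by
  choose L hL using hconv
  set ρ : S → ℝ := fun s => θ 0 s / θ 0 sStar with hρ
  set Λ : S → ℕ → ℝ := fun s n => ∏ k ∈ Finset.range n,
    G.φ s (q k) (c k) / G.φ sStar (q k) (c k) with hΛ
  have hmul := fun s n => G.bayes_eq_mul_prod hθ hθs hq hφ hsucc s n
  have hinv : ∀ n, θ n sStar = (∑ s, ρ s * Λ s n)⁻¹ := by
    intro n
    refine eq_inv_of_mul_eq_one_right ?_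
    rw [Finset.sum_mul, ← (hθ n).2]
    exact Finset.sum_congr rfl fun s _ => (hmul s n).symm
  have hsum : Tendsto (fun n => ∑ s, ρ s * Λ s n) atTop (𝓝 (∑ s, ρ s * L s)) :=
    tendsto_finsetSum _ fun s _ => (hL s).const_mul _
  -- The sums are reciprocals of `θ n sStar ≤ 1`; this keeps their limit away from zero, so
  -- inversion is continuous there.
  have hge : 1 ≤ ∑ s, ρ s * L s := by
    refine ge_of_tendsto' hsum fun n => ?_
    have h1 : θ n sStar ≤ 1 := by
      rw [← (hθ n).2]
      exact Finset.single_le_sum (fun s _ => (hθ n).1 s) (Finset.mem_univ sStar)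
    have h2 := hθs n
    rw [hinv n] at h1 h2
    rw [inv_pos] at h2
    exact (inv_le_one₀ h2).1 h1
  have hpos : 0 < ∑ s, ρ s * L s := one_pos.trans_le hge
  have hs : Tendsto (fun n => θ n sStar) atTop (𝓝 (∑ s, ρ s * L s)⁻¹) := by
    simp only [hinv]
    exact hsum.inv₀ hpos.ne'
  have hall : Tendsto θ atTop (𝓝 fun s => ρ s * L s * (∑ s, ρ s * L s)⁻¹) := by
    refine tendsto_pi_nhds.2 fun s => ?_
    exact (((hL s).const_mul (ρ s)).mul hs).congr fun n => (hmul s n).symm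
  refine ⟨_, (isClosed_stdSimplex ℝ S).mem_of_tendsto hall (Eventually.of_forall hθ), ?_, hall⟩
  have := tendsto_nhds_unique ((tendsto_pi_nhds.1 hall) sStar) hs
  exact (inv_pos.2 hpos).trans_eq this.symm

theorem bayes_le_mul_prod (s : S) (n : ℕ) :
    θ n s ≤ θ 0 s / θ 0 sStar *
      ∏ k ∈ Finset.range n, G.φ s (q k) (c k) / G.φ sStar (q k) (c k) := by
  rw [G.bayes_eq_mul_prod hθ hθs hq hφ hsucc s n]
  have h1 : θ n sStar ≤ 1 := by
    rw [← (hθ n).2]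
    exact Finset.single_le_sum (fun s _ => (hθ n).1 s) (Finset.mem_univ sStar)
  refine mul_le_of_le_one_right (mul_nonneg (div_nonneg ((hθ 0).1 s) (hθs 0).le)
    (Finset.prod_nonneg fun k _ => div_nonneg (G.φ_nonneg s _ (hq k) _) (hφ k).le)) h1

theorem eventually_bayes_le_exp {s : S} {D : ℝ≥0∞} (hΛ : ∀ r : ℝ, ENNReal.ofReal r < D →
      ∀ᶠ n : ℕ in atTop, ∏ k ∈ Finset.range n, G.φ s (q k) (c k) / G.φ sStar (q k) (c k)
        ≤ Real.exp (-(r * n))) {r : ℝ} (hr : ENNReal.ofReal r < D) :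
    ∀ᶠ n : ℕ in atTop, θ n s ≤ Real.exp (-(r * (n + 1))) := by
  -- The excess `r' - r` absorbs the prior ratio and the factor `exp r` due to index `n` being step
  -- `n + 1`.
  obtain ⟨r', hrr', -, hr'⟩ := exists_pos_lt_of_ofReal_lt hr
  set ρ := θ 0 s / θ 0 sStar with hρ
  have hρ0 : 0 ≤ ρ := div_nonneg ((hθ 0).1 s) (hθs 0).le
  have hlim : Tendsto (fun n : ℕ => ρ * Real.exp r * Real.exp (-((r' - r) * n))) atTop (𝓝 0) := by
    have h1 : Tendsto (fun n : ℕ => (r' - r) * (n : ℝ)) atTop atTop :=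
      tendsto_natCast_atTop_atTop.const_mul_atTop (sub_pos.2 hrr')
    have := (Real.tendsto_exp_neg_atTop_nhds_zero.comp h1).const_mul (ρ * Real.exp r)
    rwa [mul_zero] at this
  filter_upwards [hΛ r' hr', hlim.eventually (gt_mem_nhds one_pos)] with n h1 h2
  calc θ n s ≤ ρ * Real.exp (-(r' * n)) :=
        (G.bayes_le_mul_prod hθ hθs hq hφ hsucc s n).trans (mul_le_mul_of_nonneg_left h1 hρ0)
    _ = ρ * Real.exp r * Real.exp (-((r' - r) * n)) * Real.exp (-(r * (n + 1))) := by
        rw [mul_assoc, mul_assoc, ← Real.exp_add, ← Real.exp_add]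
        congr 2
        ring
    _ ≤ _ := mul_le_of_le_one_left (Real.exp_pos _).le h2.le

/-- The prior term is constant and `log (θ n sStar)` converges because `θbar sStar > 0`, so only the
likelihood ratio contributes to the rate. -/
theorem tendsto_log_bayes {θbar : S → ℝ} (hθbar : Tendsto θ atTop (𝓝 θbar))
    (hθbars : 0 < θbar sStar) {s : S} (hpos : ∀ n, 0 < θ n s) {D : ℝ}
    (hΛ : (∀ n, 0 < ∏ k ∈ Finset.range n, G.φ s (q k) (c k) / G.φ sStar (q k) (c k)) →
      Tendsto (fun n : ℕ => (n : ℝ)⁻¹ * Real.log (∏ k ∈ Finset.range n,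
        G.φ s (q k) (c k) / G.φ sStar (q k) (c k))) atTop (𝓝 D)) :
    Tendsto (fun n : ℕ => 1 / ((n : ℝ) + 1) * Real.log (θ n s)) atTop (𝓝 D) := by
  have hmul := fun n => G.bayes_eq_mul_prod hθ hθs hq hφ hsucc s n
  set Λ : ℕ → ℝ := fun n => ∏ k ∈ Finset.range n,
    G.φ s (q k) (c k) / G.φ sStar (q k) (c k) with hΛdef
  have hρ : 0 < θ 0 s / θ 0 sStar := div_pos (hpos 0) (hθs 0)
  have hΛ0 : ∀ n, 0 < Λ n := fun n => by
    have h1 := hpos n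
    rw [hmul n] at h1
    exact pos_of_mul_pos_right (pos_of_mul_pos_left h1 (hθs n).le) hρ.le
  have h1 := hΛ hΛ0
  have hlog : Tendsto (fun n => Real.log (θ n sStar)) atTop (𝓝 (Real.log (θbar sStar))) :=
    ((tendsto_pi_nhds.1 hθbar) sStar).log hθbars.ne'
  have h2 := (tendsto_one_div_add_atTop_nhds_zero_nat (𝕜 := ℝ)).mul
    (hlog.const_add (Real.log (θ 0 s / θ 0 sStar)))
  have h3 := (tendsto_natCast_div_add_atTop (1 : ℝ)).mul h1
  have h4 := h2.add h3
  rw [zero_mul, zero_add, one_mul] at h4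
  refine h4.congr' ?_
  filter_upwards [eventually_gt_atTop 0] with n hn
  have hn0 : (n : ℝ) ≠ 0 := by exact_mod_cast hn.ne'
  rw [hmul n, Real.log_mul (mul_pos hρ (hΛ0 n)).ne' (hθs n).ne',
    Real.log_mul hρ.ne' (hΛ0 n).ne']
  field_simp
  ring

theorem eventually_bayes_eq_zero {s : S} (h : ∃ k, G.φ s (q k) (c k) = 0) :
    ∀ᶠ n in atTop, θ n s = 0 := by
  obtain ⟨k, hk⟩ := h
  filter_upwards [eventually_gt_atTop k] with n hn
  rw [G.bayes_eq_mul_prod hθ hθs hq hφ hsucc s n,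
    Finset.prod_eq_zero (Finset.mem_range.2 hn) (by rw [hk, zero_div]), mul_zero, zero_mul]

end BayesianBeliefs

theorem tendsto_strategy (G : ParametricGame I S d) {g : (S → ℝ) → Profile d}
    (hg_cont : ContinuousOn g (stdSimplex ℝ S)) {a : ℕ → I → ℝ}
    (ha : ∀ k i, a k i ∈ Set.Icc (0 : ℝ) 1)
    (ha_prod : ∀ i, ∀ m : ℕ,
      Tendsto (fun n : ℕ => ∏ k ∈ Finset.Ico m n, (1 - a k i)) atTop (𝓝 0))
    {θ₁ : S → ℝ} {q₁ : Profile d} {c : ℕ → I → ℝ}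
    (hθ : ∀ k, G.belief g a θ₁ q₁ c k ∈ stdSimplex ℝ S) {θbar : S → ℝ}
    (hθbar : θbar ∈ stdSimplex ℝ S) (h : Tendsto (G.belief g a θ₁ q₁ c) atTop (𝓝 θbar)) :
    Tendsto (G.strategy g a θ₁ q₁ c) atTop (𝓝 (g θbar)) := by
  -- The shift by one reflects that each move is towards the equilibrium of the already updated
  -- belief.
  have hgt : Tendsto (fun k => g (G.belief g a θ₁ q₁ c (k + 1))) atTop (𝓝 (g θbar)) :=
    (hg_cont θbar hθbar).tendsto.comp
      ((tendsto_nhdsWithin_iff.2 ⟨h, Eventually.of_forall hθ⟩).comp (tendsto_add_atTop_nat 1))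
  exact tendsto_pi_nhds.2 fun i => tendsto_of_convex_step (fun k => ha k i) (ha_prod i)
    (fun k => rfl) (tendsto_pi_nhds.1 hgt i)

end ParametricGame

/-! ### The main theorem -/

theorem mainTheorem1 {I S : Type*} [Fintype I] [Fintype S] {d : I → ℕ}
    (G : ParametricGame I S d) (sStar : S)
    -- the equilibrium selection (A1)
    (g : (S → ℝ) → Profile d)
    (hg_eq : ∀ θ ∈ stdSimplex ℝ S, g θ ∈ G.equilibria θ)
    (hg_cont : ContinuousOn g (stdSimplex ℝ S))
    -- the stepsizes (A2)
    (a : ℕ → I → ℝ) (ha : ∀ k i, a k i ∈ Set.Icc (0 : ℝ) 1)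
    (ha_prod : ∀ i, ∀ m : ℕ,
      Tendsto (fun n : ℕ => ∏ k ∈ Finset.Ico m n, (1 - a k i)) atTop (𝓝 0))
    -- the initial state
    (θ₁ : S → ℝ) (hθ₁ : θ₁ ∈ stdSimplex ℝ S) (hθ₁_pos : ∀ s, 0 < θ₁ s)
    (q₁ : Profile d) (hq₁ : q₁ ∈ G.profiles)
    -- the realized payoffs
    {Ω : Type*} [MeasurableSpace Ω] (P : Measure Ω) [IsProbabilityMeasure P]
    (c : ℕ → Ω → I → ℝ) (hc : G.IsPayoffSequence sStar g a θ₁ q₁ P c) :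
    ∀ᵐ ω ∂P, ∃ θbar ∈ stdSimplex ℝ S, ∃ qbar ∈ G.profiles,
      Tendsto (G.belief g a θ₁ q₁ (fun j => c j ω)) atTop (𝓝 θbar) ∧
      Tendsto (G.strategy g a θ₁ q₁ (fun j => c j ω)) atTop (𝓝 qbar) ∧
      {s | 0 < θbar s} ⊆ G.payoffEquivalent sStar qbar ∧
      qbar = g θbar ∧ qbar ∈ G.equilibria θbar ∧
      ∀ s ∉ G.payoffEquivalent sStar qbar,
        -- exponential decay, at every rate below the divergence
        (∀ r : ℝ, ENNReal.ofReal r < G.payoffKL sStar s qbar →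
          ∀ᶠ k : ℕ in atTop,
            G.belief g a θ₁ q₁ (fun j => c j ω) k s ≤ Real.exp (-(r * (k + 1)))) ∧
        -- exact rate
        (G.LocalLogMomentBound sStar s qbar →
          (∀ k, 0 < G.belief g a θ₁ q₁ (fun j => c j ω) k s) →
          Tendsto (fun k : ℕ => 1 / ((k : ℝ) + 1) *
              Real.log (G.belief g a θ₁ q₁ (fun j => c j ω) k s)) atTop
            (𝓝 (-(G.payoffKL sStar s qbar).toReal))) ∧
        -- exclusion in finite time
        (¬ G.payoffLaw sStar qbar ≪ G.payoffLaw s qbar →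
          ContinuousWithinAt (fun q => G.payoffLaw sStar q {y | G.φ s q y = 0})
            G.profiles qbar →
          ∀ᶠ k : ℕ in atTop, G.belief g a θ₁ q₁ (fun j => c j ω) k s = 0) := by
  have hg : ∀ θ ∈ stdSimplex ℝ S, g θ ∈ G.profiles := fun θ hθ => (hg_eq θ hθ).1
  set θ₁' : ParametricGame.PosBelief sStar := ⟨θ₁, hθ₁, hθ₁_pos sStar⟩
  set q₁' : G.profiles := ⟨q₁, hq₁⟩
  have hsamp := G.sequentialSampling_safeState hg ha θ₁' q₁' hg_cont hc
  have hfam := G.isContinuousDensityFamily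
  have hκ := G.payoffKernel_apply sStar
  filter_upwards [ae_all_iff.2 (G.ae_state_eq_safeState hg ha θ₁' q₁' hg_cont hc),
    hsamp.ae_density_pos (hfam sStar) hκ,
    ae_all_iff.2 fun s => hsamp.ae_tendsto_prod_div (hfam sStar) (hfam s) hκ,
    ae_all_iff.2 fun s => hsamp.ae_eventually_prod_div_le (hfam sStar) (hfam s) hκ,
    ae_all_iff.2 fun s => hsamp.ae_tendsto_log_prod_div (hfam sStar) (hfam s) hκ,
    ae_all_iff.2 fun s => hsamp.ae_exists_density_eq_zero (hfam sStar) (hfam s) hκ]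
    with ω hstate hpos hconv hdecay hrate hzero
  set x : ℕ → G.profiles := fun k => (G.safeState hg ha θ₁' q₁' (fun j => c j ω) k).2
  set θ := G.belief g a θ₁ q₁ (fun j => c j ω) with hθdef
  have hθx : ∀ k, θ k = (G.safeState hg ha θ₁' q₁' (fun j => c j ω) k).1 := fun k =>
    congrArg Prod.fst (hstate k)
  have hqx : ∀ k, G.strategy g a θ₁ q₁ (fun j => c j ω) k = x k := fun k =>
    congrArg Prod.snd (hstate k)
  have hθ : ∀ k, θ k ∈ stdSimplex ℝ S := fun k => by
    rw [hθx]
    exact (G.safeState hg ha θ₁' q₁' (fun j => c j ω) k).1.2.1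
  have hθs : ∀ k, 0 < θ k sStar := fun k => by
    rw [hθx]
    exact (G.safeState hg ha θ₁' q₁' (fun j => c j ω) k).1.2.2
  have hsucc : ∀ k, θ (k + 1) = G.bayesUpdate (θ k) (x k : Profile d) (c k ω) := fun k => by
    rw [← hqx]
    rfl
  have hxq : ∀ k, (x k : Profile d) ∈ G.profiles := fun k => (x k).2
  obtain ⟨θbar, hθbar, hθbars, hθt⟩ :=
    G.exists_tendsto_bayes (c := fun k => c k ω) hθ hθs hxq hpos hsucc hconv
  have hqt := G.tendsto_strategy hg_cont ha ha_prod hθ hθbar hθt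
  set xbar : G.profiles := ⟨g θbar, hg θbar hθbar⟩
  have hxt : Tendsto x atTop (𝓝 xbar) := by
    rw [tendsto_subtype_rng]
    exact hqt.congr hqx
  have hdec : ∀ s, ∀ r : ℝ, ENNReal.ofReal r < G.payoffKL sStar s (g θbar) →
      ∀ᶠ k : ℕ in atTop, θ k s ≤ Real.exp (-(r * (k + 1))) := fun s r hr =>
    G.eventually_bayes_le_exp (c := fun k => c k ω) hθ hθs hxq hpos hsucc
      (hdecay s xbar hxt) hr
  refine ⟨θbar, hθbar, g θbar, hg θbar hθbar, hθt, hqt, fun s hs => ?_, rfl, hg_eq θbar hθbar,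
    fun s hs => ⟨hdec s, fun hmom hθpos => ?_, fun hac hcont => ?_⟩⟩
  -- A parameter with positive divergence at the limit has exponentially decaying belief, so its
  -- limit belief cannot be positive.
  · by_contra hne
    have h0 : ENNReal.ofReal 0 < G.payoffKL sStar s (g θbar) := by
      rw [ENNReal.ofReal_zero]
      exact bot_lt_iff_ne_bot.2 hne
    obtain ⟨r, -, hr0, hr⟩ := exists_pos_lt_of_ofReal_lt h0
    have h1 : Tendsto (fun k : ℕ => Real.exp (-(r * ((k : ℝ) + 1)))) atTop (𝓝 0) :=
      Real.tendsto_exp_neg_atTop_nhds_zero.comp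
        ((tendsto_atTop_add_const_right _ 1 tendsto_natCast_atTop_atTop).const_mul_atTop hr0)
    exact hs.not_ge (le_of_tendsto_of_tendsto (tendsto_pi_nhds.1 hθt s) h1 (hdec s r hr))
  · obtain ⟨p, hp, C, hC⟩ := hmom
    refine G.tendsto_log_bayes (c := fun k => c k ω) hθ hθs hxq hpos hsucc hθt hθbars hθpos
      fun hΛ => hrate s xbar hxt (bot_lt_iff_ne_bot.2 hs) p hp C ?_ hΛ
    -- Neighbourhoods of `qbar` within the feasible set are those of `xbar` in the subtype on which
    -- the kernel lives.
    rw [nhdsWithin_eq_map_subtype_coe (hg θbar hθbar), eventually_map] at hC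
    exact hC
  · refine G.eventually_bayes_eq_zero (c := fun k => c k ω) hθ hθs hxq hpos hsucc
      (hzero s xbar hxt hac ?_)
    exact (continuousWithinAt_iff_continuousAt_domRestrict _ (hg θbar hθbar)).1 hcont
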